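/- **Theorem 1.2.** Let $a,b\in\mathbb R$ with $b\neq 0$, let $\delta\in(0,1)$ and $S_0>0$. Let $V=(V_1,V_2,V_3)\in C^1_sC^{1,\delta}_y(\mathbb R^{3+1})$, with $\operatorname{curl}V\in C^1(\mathbb R^{3+1})$, be a vector field that is time periodic, $V(y,s+S_0)=V(y,s)$ for all $(y,s)\in\mathbb R^3\times\mathbb R$, and that solves, with some scalar function $P(y,s)$ differentiable in $y$, $$\partial_sV+aV+b(y\cdot\nabla)V+(V\cdot\nabla)V=-\nabla P,\qquad \operatorname{div}V=0\qquad\text{on }\mathbb R^3\times\mathbb R .$$ Assume that for all $s\in(0,S_0)$ and $i=1,2,3$ the origin $y=0$ is a point of local extremum (maximum or minimum) of $V_i(\cdot,s)$, and moreover: (i) if either $a+b>0$ and $b>0$, or $a+b<0$ and $b<0$: $V(0,s)=0$ for all $s\in(0,S_0)$; (ii) if either $a+b\le 0$ and $b>0$, or $a+b\ge 0$ and $b<0$: there exist $\rho>0$ and $\beta>\frac{|a+b|}{|b|}+2$ such that $$V\in C^1_sC^{\beta}_y(B_\rho\times(0,S_0)),\qquad D^kV(0,s)=0\quad\text{for all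 } k=0,\dots,[\beta],\ s\in(0,S_0),$$ where $B_\rho=\{y\in\mathbb R^3:|y|<\rho\}$, $D^k$ is the $k$-th derivative in $y$, and $[\beta]$ is the integer part of $\beta$. Then $V=0$ on $\mathbb R^3\times\mathbb R$. Here $V\in C^1_sC^{k,\gamma}_y(U\times I)$, for open $U\subset\mathbb R^3$, $I\subset\mathbb R$, $k\in\mathbb N$ and $\gamma\in[0,1)$, means that $\partial_sV$ and all spatial derivatives of $V$ of order at most $k$ exist and are continuous on $U\times I$, and that the $k$-th spatial derivatives are Hölder continuous in $y$ with exponent $\gamma$, with a constant uniform on each compact subset of $U\times I$ (for $\gamma=0$ this last requirement is void); $C^1_sC^\beta_y=C^1_sC^{[\beta],\beta-[\beta]}_y$. No condition at spatial infinity is imposed. -/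

import Mathlib

/-- Three dimensional Euclidean space. -/
abbrev E3 : Type := EuclideanSpace ℝ (Fin 3)

/-- The partial derivative `∂ⱼ Fᵢ (y)` of the `i`-th component of a vector field. -/
noncomputable def partialComp (F : E3 → E3) (j i : Fin 3) (y : E3) : ℝ :=
  fderiv ℝ F y (EuclideanSpace.single j 1) i

/-- The divergence of a vector field on `ℝ³`. -/
noncomputable def divergence (F : E3 → E3) (y : E3) : ℝ :=
  ∑ i, partialComp F i i y

/-- The curl of a vector field on `ℝ³`. -/
noncomputable def curl (F : E3 → E3) (y : E3) : E3 :=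
  !₂[partialComp F 1 2 y - partialComp F 2 1 y,
     partialComp F 2 0 y - partialComp F 0 2 y,
     partialComp F 0 1 y - partialComp F 1 0 y]

/-- `V` is of class `C¹` in `s` and `C^{k,γ}` in `y` on `U × I` (both sets open): the derivative
`∂ₛV` and the spatial derivatives of order at most `k` exist and are continuous in `(y, s)`, and
the spatial derivatives of order `k` are `γ`-Hölder continuous in `y`, with constants that are
uniform on compact subsets of `U × I`. No growth or decay condition is contained in this. For
`γ = 0` the last condition follows from continuity, and the class is `C¹` in `s`, `Cᵏ` in `y`. -/
structure IsC1TimeHolderSpace (k : ℕ) (γ : ℝ) (U : Set E3) (I : Set ℝ) (V : E3 → ℝ → E3) :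
    Prop where
  differentiableAt_time : ∀ y ∈ U, ∀ s ∈ I, DifferentiableAt ℝ (V y) s
  continuousOn_deriv_time : ContinuousOn (fun p : E3 × ℝ => deriv (V p.1) p.2) (U ×ˢ I)
  contDiffOn_space : ∀ s ∈ I, ContDiffOn ℝ k (fun y => V y s) U
  continuousOn_space : ∀ j ≤ k, ContinuousOn
    (fun p : E3 × ℝ => iteratedFDeriv ℝ j (fun y => V y p.2) p.1) (U ×ˢ I)
  holder_space : ∀ K ⊆ U, IsCompact K → ∀ J ⊆ I, IsCompact J →
    ∃ C : ℝ, ∀ s ∈ J, ∀ y₁ ∈ K, ∀ y₂ ∈ K,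
      ‖iteratedFDeriv ℝ k (fun y => V y s) y₁ - iteratedFDeriv ℝ k (fun y => V y s) y₂‖
        ≤ C * ‖y₁ - y₂‖ ^ γ

/-- `(V, P)` solves, on all of `ℝ³ × ℝ`, the system
`∂ₛV + a V + b (y · ∇) V + (V · ∇) V = -∇P`, `div V = 0`. -/
structure IsSelfSimilarEulerSolution (a b : ℝ) (V : E3 → ℝ → E3) (P : E3 → ℝ → ℝ) : Prop where
  differentiable_pressure : ∀ s, Differentiable ℝ (fun y => P y s)
  momentum : ∀ y s,
    deriv (V y) s + a • V y s + b • fderiv ℝ (fun z => V z s) y y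
      + fderiv ℝ (fun z => V z s) y (V y s) = -gradient (fun z => P z s) y
  incompressible : ∀ y s, divergence (fun z => V z s) y = 0

/-! The vorticity `ω = curl V` is transported by the field `u = b y + V`: `∂ₛω + (u · ∇)ω = -(a + b)
ω + (ω · ∇)V`. Replacing `V(y, s)` by `-V(y, -s)` changes the signs of `a` and `b`, so one may take
`b > 0`. Since `V` vanishes at the origin and its components have local extrema there, `DV(0, s) =
0`. Near the origin `u` is then close to `b y` and points outward, while the growth rate of `|ω|`
along `u` is close to `-(a + b)`.

Choose `m` with `m b + (a + b) > 0` and `ω = o(|y|^m)` at one time: `m = 0` in case (i), and an `m`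
supplied by the vanishing of the Taylor polynomial in case (ii). Along `u` the quotient `|ω| /
|y|^m` decreases strictly wherever `ω ≠ 0`. By time periodicity it would attain a positive maximum
in space-time, which is impossible, so `ω = 0` in a small ball (`eq_zero_of_periodic_transport`,
`vorticity_eq_zero_of_bounds`).

In that ball `V` is curl and divergence free, so its components are harmonic. The mean value
property at a local extremum makes them vanish near `0`, and unique continuation
(`CurlDivFree.eq_zero`) extends this to the ball.

Finally, the ball where `V = 0` grows without bound (`eq_zero_of_eq_zero_near`). On a slightly
larger ball `V` is small compared with `b y`, so `u` still points outward; `ω` vanishes to every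
order at `0`, so `m` can be chosen to beat any bound on `DV`. The transport argument and unique
continuation then apply again. Everything takes place on bounded balls, so no condition at infinity
enters.

`V` and `ω` are only `C¹`, and the pressure is only differentiable in `y`. Hence the vorticity
equation and harmonicity come from integration against test functions. -/

open Set Filter Topology Function MeasureTheory Asymptotics
open scoped RealInnerProductSpace ContDiff FourierTransform

/-! ### Maximum principle for transport along an outward field -/

section Transport

variable {E : Type*} [NormedAddCommGroup E] [InnerProductSpace ℝ E]

/-- At a maximum of `h` over a ball and the times before, the derivative along a field that points
out of the ball is nonnegative. -/
theorem fderiv_nonneg_of_max_of_outward {h : E × ℝ → ℝ} {h' : E × ℝ →L[ℝ] ℝ} {y u : E}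
    {s s₁ r c L : ℝ} (hh : HasFDerivAt h h' (y, s)) (hs : s₁ < s) (hc : 0 < c)
    (hyu : c * ‖y‖ ^ 2 ≤ ⟪y, u⟫) (hu : ‖u‖ ≤ L * ‖y‖) (hy : ‖y‖ ≤ r)
    (hmax : ∀ z t, ‖z‖ ≤ r → s₁ ≤ t → t ≤ s → h (z, t) ≤ h (y, s)) :
    0 ≤ h' (u, 1) := by
  by_contra! hneg
  have hγ : HasDerivAt (fun t : ℝ => ((y, s) : E × ℝ) - t • ((u, 1) : E × ℝ))
      (-((u, 1) : E × ℝ)) 0 := by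
    simpa using ((hasDerivAt_id (0 : ℝ)).smul_const ((u, 1) : E × ℝ)).const_sub (y, s)
  have hφ : HasDerivAt (fun t : ℝ => h (((y, s) : E × ℝ) - t • ((u, 1) : E × ℝ)))
      (h' (-(u, 1))) 0 := by
    have h0 : HasFDerivAt h h' (((y, s) : E × ℝ) - (0 : ℝ) • ((u, 1) : E × ℝ)) := by simpa using hh
    exact h0.comp_hasDerivAt (0 : ℝ) hγ
  have hpos : 0 < h' (-(u, 1)) := by rw [map_neg]; linarith
  have hev := (hasDerivAt_iff_tendsto_slope.1 hφ).eventually (lt_mem_nhds hpos)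
  have hev' : ∀ᶠ t in 𝓝[>] (0 : ℝ),
      0 < slope (fun t : ℝ => h (((y, s) : E × ℝ) - t • ((u, 1) : E × ℝ))) 0 t :=
    hev.filter_mono (nhdsWithin_mono _ (fun t ht => ne_of_gt ht))
  have h1 : ∀ᶠ t in 𝓝[>] (0 : ℝ), t < s - s₁ :=
    nhdsWithin_le_nhds (gt_mem_nhds (by linarith))
  have h2 : ∀ᶠ t in 𝓝[>] (0 : ℝ), t * L ^ 2 < 2 * c := by
    refine nhdsWithin_le_nhds (Tendsto.eventually_lt_const (v := (0 : ℝ)) (by linarith) ?_)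
    have hct : Continuous fun t : ℝ => t * L ^ 2 := by fun_prop
    simpa using hct.tendsto 0
  obtain ⟨t, ht, ht1, ht2, ht0⟩ := (hev'.and (h1.and (h2.and self_mem_nhdsWithin))).exists
  have ht0 : 0 < t := ht0
  rw [slope_def_field, sub_zero] at ht
  have hlt := (div_pos_iff_of_pos_right ht0).1 ht
  simp only [zero_smul, sub_zero] at hlt
  -- `‖y - t u‖² - ‖y‖² ≤ t ‖y‖² (t L² - 2c) ≤ 0`: a short straight backward segment stays in the
  -- ball even from a boundary point, so no flow of `u` has to be constructed.
  have hn : ‖y - t • u‖ ≤ r := by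
    refine le_trans ?_ hy
    refine abs_le_of_sq_le_sq' ?_ (norm_nonneg _) |>.2
    rw [@norm_sub_sq_real, inner_smul_right, norm_smul, Real.norm_of_nonneg ht0.le]
    have : ‖u‖ ^ 2 ≤ L ^ 2 * ‖y‖ ^ 2 := by
      rw [← mul_pow]; exact pow_le_pow_left₀ (norm_nonneg _) hu 2
    have h3 : t * ‖u‖ ^ 2 ≤ 2 * c * ‖y‖ ^ 2 := by
      calc t * ‖u‖ ^ 2 ≤ t * (L ^ 2 * ‖y‖ ^ 2) := by gcongr
        _ = (t * L ^ 2) * ‖y‖ ^ 2 := by ring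
        _ ≤ 2 * c * ‖y‖ ^ 2 := by gcongr
    nlinarith [mul_le_mul_of_nonneg_left h3 ht0.le, mul_le_mul_of_nonneg_left hyu ht0.le]
  have := hmax (y - t • u) (s - t) hn (by linarith) (by linarith)
  simp only [Prod.smul_mk, Prod.mk_sub_mk, smul_eq_mul, mul_one] at hlt
  linarith

theorem hasFDerivAt_norm_fst_sq_pow (m : ℕ) (p : E × ℝ) (u : E) :
    ∃ h' : E × ℝ →L[ℝ] ℝ, HasFDerivAt (fun q : E × ℝ => (‖q.1‖ ^ 2) ^ m) h' p ∧
      h' (u, 1) = m * (‖p.1‖ ^ 2) ^ (m - 1) * (2 * ⟪p.1, u⟫) := by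
  have := ((hasFDerivAt_fst (𝕜 := ℝ) (p := p)).norm_sq).pow m
  exact ⟨_, this, by simp⟩

variable {w : E × ℝ → E} {u : E × ℝ → E} {r c L κ : ℝ} {m : ℕ}

/-- Carries the order of vanishing from one time to later times. Outward transport can only decrease
the comparison with `‖y‖^(2m)`, apart from exponential growth in time, so a positive maximum of the
damped difference is impossible. -/
theorem norm_sq_le_of_transport [FiniteDimensional ℝ E] (hw : Differentiable ℝ w)
    (hc : 0 < c) (hout : ∀ p : E × ℝ, ‖p.1‖ ≤ r → c * ‖p.1‖ ^ 2 ≤ ⟪p.1, u p⟫)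
    (hu : ∀ p : E × ℝ, ‖p.1‖ ≤ r → ‖u p‖ ≤ L * ‖p.1‖)
    (hκ : ∀ p : E × ℝ, ‖p.1‖ ≤ r → ⟪w p, fderiv ℝ w p (u p, 1)⟫ ≤ κ * ‖w p‖ ^ 2)
    {η s₁ T : ℝ} (hη : 0 ≤ η)
    (h₁ : ∀ y, ‖y‖ ≤ r → ‖w (y, s₁)‖ ^ 2 ≤ η * (‖y‖ ^ 2) ^ m)
    {y : E} {s : ℝ} (hy : ‖y‖ ≤ r) (hs : s ∈ Icc s₁ (s₁ + T)) :
    ‖w (y, s)‖ ^ 2 ≤ η * (‖y‖ ^ 2) ^ m * Real.exp ((2 * |κ| + 1) * (s - s₁)) := by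
  -- Strictly above `2κ`, so that the damping wins strictly, and positive, so that the exponential
  -- is monotone in time.
  set K := 2 * |κ| + 1 with hK
  set h : E × ℝ → ℝ := fun q => ‖w q‖ ^ 2 * Real.exp (-K * (q.2 - s₁)) - η * (‖q.1‖ ^ 2) ^ m
    with hh
  have hcont : Continuous h := by
    have := hw.continuous
    fun_prop
  have hcomp : IsCompact (Metric.closedBall (0 : E) r ×ˢ Icc s₁ (s₁ + T)) :=
    (isCompact_closedBall _ _).prod isCompact_Icc
  obtain ⟨⟨y₀, s₀⟩, ⟨hy₀, hs₀⟩, hmax⟩ := hcomp.exists_isMaxOn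
    ⟨(y, s), by simpa using hy, hs⟩ hcont.continuousOn
  simp only [Metric.mem_closedBall, dist_zero_right] at hy₀
  have hle : h (y₀, s₀) ≤ 0 := by
    by_contra! hpos
    have hκ₀ := hκ (y₀, s₀) hy₀
    have hout₀ : c * ‖y₀‖ ^ 2 ≤ ⟪y₀, u (y₀, s₀)⟫ := hout (y₀, s₀) hy₀
    have hu₀ : ‖u (y₀, s₀)‖ ≤ L * ‖y₀‖ := hu (y₀, s₀) hy₀
    have hs₀' : s₁ < s₀ := by
      rcases hs₀.1.eq_or_lt with h0 | h0
      · simp only at h0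
        subst h0
        have := h₁ y₀ hy₀
        simp only [hh, sub_self, mul_zero, Real.exp_zero, mul_one] at hpos
        linarith
      · exact h0
    obtain ⟨n', hn', hn'u⟩ := hasFDerivAt_norm_fst_sq_pow m (y₀, s₀) (u (y₀, s₀))
    have he : HasFDerivAt (fun q : E × ℝ => Real.exp (-K * (q.2 - s₁))) _ (y₀, s₀) :=
      (((hasFDerivAt_snd (𝕜 := ℝ) (p := (y₀, s₀))).sub_const s₁).const_mul (-K)).exp
    have hd := (((hw (y₀, s₀)).hasFDerivAt.norm_sq).mul he).sub (hn'.const_mul η)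
    have hnn := fderiv_nonneg_of_max_of_outward (h := h) hd hs₀' hc hout₀ hu₀ hy₀
      (fun z t hz ht1 ht2 => hmax ⟨by simpa using hz, ht1, ht2.trans hs₀.2⟩)
    simp only [sub_apply, add_apply,
      smul_apply, hn'u, smul_eq_mul, ContinuousLinearMap.coe_comp,
      Function.comp, innerSL_apply_apply, ContinuousLinearMap.coe_snd', nsmul_eq_mul] at hnn
    have hin : 0 ≤ ⟪y₀, u (y₀, s₀)⟫ := le_trans (by positivity) hout₀
    have hlast : 0 ≤ η * (m * (‖y₀‖ ^ 2) ^ (m - 1) * (2 * ⟪y₀, u (y₀, s₀)⟫)) := by positivity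
    have hexp := Real.exp_pos (-K * (s₀ - s₁))
    have hwpos : 0 < ‖w (y₀, s₀)‖ ^ 2 := by
      by_contra! hw0
      have h0 : ‖w (y₀, s₀)‖ ^ 2 = 0 := le_antisymm hw0 (by positivity)
      simp only [hh, h0, zero_mul] at hpos
      have : 0 ≤ η * (‖y₀‖ ^ 2) ^ m := by positivity
      linarith
    have hlt : 2 * ⟪w (y₀, s₀), fderiv ℝ w (y₀, s₀) (u (y₀, s₀), 1)⟫ < K * ‖w (y₀, s₀)‖ ^ 2 := by
      have := mul_le_mul_of_nonneg_right (le_abs_self κ) hwpos.le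
      rw [hK]; linarith
    have := mul_lt_mul_of_pos_right hlt hexp
    push_cast at hnn
    linarith
  have hfin : h (y, s) ≤ 0 := (hmax ⟨by simpa using hy, hs⟩).trans hle
  simp only [hh] at hfin
  have he := Real.exp_pos (K * (s - s₁))
  have h1 := mul_le_mul_of_nonneg_right (sub_nonpos.1 hfin) he.le
  rwa [mul_assoc, ← Real.exp_add, neg_mul, neg_add_cancel, Real.exp_zero, mul_one] at h1

/-- A time periodic solution of a transport inequality along a field that points away from the
origin vanishes, when it vanishes to sufficiently high order at the origin at one time. -/
theorem eq_zero_of_periodic_transport [FiniteDimensional ℝ E] (hw : Differentiable ℝ w)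
    {S : ℝ} (hS : 0 < S) (hper : ∀ y s, w (y, s + S) = w (y, s))
    (hc : 0 < c) (hout : ∀ p : E × ℝ, ‖p.1‖ ≤ r → c * ‖p.1‖ ^ 2 ≤ ⟪p.1, u p⟫)
    (hu : ∀ p : E × ℝ, ‖p.1‖ ≤ r → ‖u p‖ ≤ L * ‖p.1‖)
    (hκ : ∀ p : E × ℝ, ‖p.1‖ ≤ r → ⟪w p, fderiv ℝ w p (u p, 1)⟫ ≤ κ * ‖w p‖ ^ 2)
    (hm : κ < m * c) {s₁ : ℝ}
    (h₁ : ∀ η > 0, ∃ ρ > 0, ∀ y, ‖y‖ ≤ ρ → ‖w (y, s₁)‖ ^ 2 ≤ η * (‖y‖ ^ 2) ^ m)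
    {y : E} (hy : ‖y‖ ≤ r) (s : ℝ) : w (y, s) = 0 := by
  have hperiodic : ∀ y, Function.Periodic (fun s => w (y, s)) S := fun y s => hper y s
  have hunif : ∀ η > 0, ∃ ρ > 0, ∀ y s, ‖y‖ ≤ ρ → ‖y‖ ≤ r →
      ‖w (y, s)‖ ^ 2 ≤ η * (‖y‖ ^ 2) ^ m := by
    intro η hη
    set e := Real.exp ((2 * |κ| + 1) * S)
    have he : 0 < e := Real.exp_pos _
    obtain ⟨ρ, hρ, h⟩ := h₁ (η / e) (by positivity)
    refine ⟨ρ, hρ, fun y s hyρ hyr => ?_⟩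
    obtain ⟨t, ht, hst⟩ := (hperiodic y).exists_mem_Ico hS s s₁
    rw [hst]
    have h2 := norm_sq_le_of_transport (r := min ρ r) (m := m) (T := S) hw hc
      (fun p hp => hout p (hp.trans (min_le_right _ _)))
      (fun p hp => hu p (hp.trans (min_le_right _ _)))
      (fun p hp => hκ p (hp.trans (min_le_right _ _))) (η := η / e) (s₁ := s₁) (by positivity)
      (fun y hy => h y (hy.trans (min_le_left _ _))) (le_min hyρ hyr) (Ico_subset_Icc_self ht)
    refine h2.trans ?_
    have h3 : Real.exp ((2 * |κ| + 1) * (t - s₁)) ≤ e := by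
      apply Real.exp_le_exp.2
      have : t - s₁ ≤ S := by linarith [ht.2]
      gcongr
    calc η / e * (‖y‖ ^ 2) ^ m * Real.exp ((2 * |κ| + 1) * (t - s₁))
        ≤ η / e * (‖y‖ ^ 2) ^ m * e := by gcongr
      _ = η * (‖y‖ ^ 2) ^ m := by field_simp
  by_contra hne
  have hwpos : 0 < ‖w (y, s)‖ ^ 2 := by positivity
  -- The quotient by `‖y‖^(2m)` needs `y ≠ 0`. At the origin the uniform bound with half of `‖w‖²`
  -- is already contradictory, also for `m = 0`.
  have hy0 : 0 < ‖y‖ ^ 2 := by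
    by_contra! h0
    have hyz : ‖y‖ ^ 2 = 0 := le_antisymm h0 (by positivity)
    have hyz' : ‖y‖ = 0 := by simpa using hyz
    obtain ⟨ρ, hρ, h⟩ := hunif (‖w (y, s)‖ ^ 2 / 2) (by positivity)
    have h2 := h y s (by rw [hyz']; exact hρ.le) hy
    have h3 : (‖y‖ ^ 2) ^ m ≤ 1 := pow_le_one₀ (by positivity) (by rw [hyz]; norm_num)
    nlinarith
  set g : E × ℝ → ℝ := fun q => ‖w q‖ ^ 2 / (‖q.1‖ ^ 2) ^ m with hg
  have hg0 : 0 < g (y, s) := by simp only [hg]; positivity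
  obtain ⟨ρ, hρ, hρ'⟩ := hunif (g (y, s) / 2) (by positivity)
  have hyρ : ρ < ‖y‖ := by
    by_contra! hle
    have h2 := hρ' y s hle hy
    have h3 : g (y, s) * (‖y‖ ^ 2) ^ m = ‖w (y, s)‖ ^ 2 := by simp only [hg]; field_simp
    have h4 : 0 < g (y, s) * (‖y‖ ^ 2) ^ m := by positivity
    linarith
  have hcomp : IsCompact ((Metric.closedBall (0 : E) r ∩ {z | ρ ≤ ‖z‖}) ×ˢ Icc s (s + S)) :=
    ((isCompact_closedBall _ _).inter_right (isClosed_le continuous_const continuous_norm)).prod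
      isCompact_Icc
  have hgc : ContinuousOn g ((Metric.closedBall (0 : E) r ∩ {z | ρ ≤ ‖z‖}) ×ˢ Icc s (s + S)) := by
    have := hw.continuous
    refine ContinuousOn.div (by fun_prop) (by fun_prop) ?_
    rintro ⟨z, t⟩ ⟨⟨-, hz⟩, -⟩
    have : 0 < ‖z‖ := hρ.trans_le hz
    positivity
  obtain ⟨⟨y₀, s₀⟩, ⟨⟨hy₀, hy₀ρ⟩, hs₀⟩, hmax⟩ := hcomp.exists_isMaxOn
    ⟨(y, s), ⟨by simpa using hy, hyρ.le⟩, le_rfl, by linarith⟩ hgc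
  simp only [Metric.mem_closedBall, dist_zero_right] at hy₀
  replace hy₀ρ : ρ ≤ ‖y₀‖ := hy₀ρ
  have hκ₀ := hκ (y₀, s₀) hy₀
  have hout₀ : c * ‖y₀‖ ^ 2 ≤ ⟪y₀, u (y₀, s₀)⟫ := hout (y₀, s₀) hy₀
  have hu₀ : ‖u (y₀, s₀)‖ ≤ L * ‖y₀‖ := hu (y₀, s₀) hy₀
  set l := g (y₀, s₀) with hl
  have hgl : g (y, s) ≤ l := hmax ⟨⟨by simpa using hy, hyρ.le⟩, le_rfl, by linarith⟩
  have hlpos : 0 < l := hg0.trans_le hgl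
  have hy₀pos : 0 < ‖y₀‖ := hρ.trans_le hy₀ρ
  -- The maximum over an annulus and one period bounds the whole ball at all times: closer than `ρ`
  -- the quotient is at most half the value at `(y, s)`, and periodicity covers the other times.
  have hglob : ∀ z t, ‖z‖ ≤ r → ‖w (z, t)‖ ^ 2 ≤ l * (‖z‖ ^ 2) ^ m := by
    intro z t hz
    rcases le_total ‖z‖ ρ with hzρ | hzρ
    · refine (hρ' z t hzρ hz).trans ?_
      gcongr
      linarith
    · obtain ⟨t', ht', htt⟩ := (hperiodic z).exists_mem_Ico hS t s
      rw [htt]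
      have h2 : g (z, t') ≤ l := hmax ⟨⟨by simpa using hz, hzρ⟩, Ico_subset_Icc_self ht'⟩
      have hzp : 0 < ‖z‖ := hρ.trans_le hzρ
      simp only [hg] at h2
      rwa [div_le_iff₀ (by positivity)] at h2
  have heq : ‖w (y₀, s₀)‖ ^ 2 = l * (‖y₀‖ ^ 2) ^ m := by
    simp only [hl, hg]; field_simp
  obtain ⟨n', hn', hn'u⟩ := hasFDerivAt_norm_fst_sq_pow m (y₀, s₀) (u (y₀, s₀))
  have hd := ((hw (y₀, s₀)).hasFDerivAt.norm_sq).sub (hn'.const_mul l)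
  -- `‖w‖² - l ‖y‖^(2m)` has maximum `0` at `(y₀, s₀)` over all times, so any earlier starting time
  -- serves.
  have hnn := fderiv_nonneg_of_max_of_outward (s₁ := s₀ - 1) hd (by linarith) hc hout₀ hu₀ hy₀
    (fun z t hz ht1 ht2 => by
      have := hglob z t hz
      simp only [Pi.sub_apply]
      linarith)
  simp only [sub_apply, smul_apply, hn'u, smul_eq_mul,
    ContinuousLinearMap.coe_comp, Function.comp, innerSL_apply_apply, nsmul_eq_mul] at hnn
  push_cast at hnn
  rw [heq] at hκ₀
  have hpw : (m : ℝ) * (‖y₀‖ ^ 2) ^ (m - 1) * ‖y₀‖ ^ 2 = m * (‖y₀‖ ^ 2) ^ m := by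
    rcases m with _ | k
    · simp
    · simp only [Nat.add_sub_cancel]; ring
  have h5 : l * (m * c * (‖y₀‖ ^ 2) ^ m) ≤
      l * (m * (‖y₀‖ ^ 2) ^ (m - 1) * ⟪y₀, u (y₀, s₀)⟫) := by
    refine mul_le_mul_of_nonneg_left ?_ hlpos.le
    calc m * c * (‖y₀‖ ^ 2) ^ m = c * (m * (‖y₀‖ ^ 2) ^ m) := by ring
      _ = m * (‖y₀‖ ^ 2) ^ (m - 1) * (c * ‖y₀‖ ^ 2) := by rw [← hpw]; ring
      _ ≤ _ := by gcongr
  -- The strict gap `κ < m c` makes the same derivative negative, which is the contradiction.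
  have h6 : 0 < (m * c - κ) * (l * (‖y₀‖ ^ 2) ^ m) := by
    have : 0 < m * c - κ := by linarith
    positivity
  linarith

end Transport

/-! ### Integration by parts and weak identities -/

section Weak

variable {E : Type*} [NormedAddCommGroup E] [NormedSpace ℝ E] [FiniteDimensional ℝ E]
  [MeasurableSpace E] [BorelSpace E] (μ : Measure E) [μ.IsAddHaarMeasure]

theorem integral_mul_fderiv_eq_neg_of_hasCompactSupport {f φ : E → ℝ} {v : E}
    (hf : Differentiable ℝ f) (hfv : Continuous fun x => fderiv ℝ f x v)
    (hφ : ContDiff ℝ 1 φ) (hc : HasCompactSupport φ) :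
    ∫ x, f x * fderiv ℝ φ x v ∂μ = - ∫ x, fderiv ℝ f x v * φ x ∂μ := by
  have hφ' : Continuous fun x => fderiv ℝ φ x v :=
    (hφ.continuous_fderiv (by simp)).clm_apply continuous_const
  have hcφ' : HasCompactSupport fun x => fderiv ℝ φ x v := hc.fderiv_apply (𝕜 := ℝ) v
  refine integral_mul_fderiv_eq_neg_fderiv_mul_of_integrable ?_ ?_ ?_ (fun x _ => hf x)
    (fun x _ => hφ.differentiable (by simp) x)
  · exact (hfv.mul hφ.continuous).integrable_of_hasCompactSupport hc.mul_left
  · exact (hf.continuous.mul hφ').integrable_of_hasCompactSupport hcφ'.mul_left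
  · exact (hf.continuous.mul hφ.continuous).integrable_of_hasCompactSupport hc.mul_left

/-- Equality of mixed second derivatives, in weak form. -/
theorem integral_fderiv_mul_fderiv_comm {f φ : E → ℝ} {v w : E} (hf : Differentiable ℝ f)
    (hfv : Continuous fun x => fderiv ℝ f x v) (hfw : Continuous fun x => fderiv ℝ f x w)
    (hφ : ContDiff ℝ 2 φ) (hc : HasCompactSupport φ) :
    ∫ x, fderiv ℝ f x v * fderiv ℝ φ x w ∂μ = ∫ x, fderiv ℝ f x w * fderiv ℝ φ x v ∂μ := by
  have hφ' : ContDiff ℝ 1 (fderiv ℝ φ) := hφ.fderiv_right (by norm_num)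
  have hφv : ∀ v, ContDiff ℝ 1 fun x => fderiv ℝ φ x v := fun v => hφ'.clm_apply contDiff_const
  have hcv : ∀ v, HasCompactSupport fun x => fderiv ℝ φ x v := fun v => hc.fderiv_apply (𝕜 := ℝ) v
  have h1 := integral_mul_fderiv_eq_neg_of_hasCompactSupport μ hf hfv (hφv w) (hcv w)
  have h2 := integral_mul_fderiv_eq_neg_of_hasCompactSupport μ hf hfw (hφv v) (hcv v)
  have hsymm : ∀ x, fderiv ℝ (fun x => fderiv ℝ φ x w) x v
      = fderiv ℝ (fun x => fderiv ℝ φ x v) x w := by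
    intro x
    have hd : DifferentiableAt ℝ (fderiv ℝ φ) x := hφ'.differentiable (by simp) x
    rw [fderiv_clm_apply hd (differentiableAt_const _), fderiv_clm_apply hd (differentiableAt_const _)]
    simpa using (hφ.contDiffAt.isSymmSndFDerivAt (x := x) (by simp)).eq v w
  simp only [hsymm] at h1
  linarith

theorem eq_zero_of_forall_integral_smooth_mul {h : E → ℝ} (hh : Continuous h)
    (h0 : ∀ φ : E → ℝ, ContDiff ℝ ∞ φ → HasCompactSupport φ → ∫ x, φ x * h x ∂μ = 0) (x : E) :
    h x = 0 := by
  have := ae_eq_zero_of_integral_contDiff_smul_eq_zero (μ := μ) (hh.locallyIntegrable) h0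
  exact congr_fun ((hh.ae_eq_iff_eq μ continuous_zero).1 this) x

end Weak

/-! ### Components of the curl, and `div curl = 0` in low regularity -/

section Curl

/-- The standard basis of `ℝ³`. -/
noncomputable abbrev e3 (j : Fin 3) : E3 := EuclideanSpace.single j 1

/-- Cyclic indices in `Fin 3` let one formula serve all three components. -/
theorem curl_apply (F : E3 → E3) (y : E3) (i : Fin 3) :
    curl F y i = partialComp F (i + 1) (i + 2) y - partialComp F (i + 2) (i + 1) y := by
  fin_cases i <;> rfl

theorem sum_smul_e3 (u : E3) : u = u 0 • e3 0 + u 1 • e3 1 + u 2 • e3 2 := by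
  ext i; fin_cases i <;> simp [e3]

theorem inner_eq_sum (x y : E3) : ⟪x, y⟫ = x 0 * y 0 + x 1 * y 1 + x 2 * y 2 := by
  simp [PiLp.inner_apply, Fin.sum_univ_three]; ring

theorem hasFDerivAt_comp {E : Type*} [NormedAddCommGroup E] [NormedSpace ℝ E] {F : E → E3}
    {F' : E →L[ℝ] E3} {x : E} (h : HasFDerivAt F F' x) (i : Fin 3) :
    HasFDerivAt (fun y => F y i) ((EuclideanSpace.proj i : E3 →L[ℝ] ℝ).comp F') x :=
  (EuclideanSpace.proj i : E3 →L[ℝ] ℝ).hasFDerivAt.comp x h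

theorem fderiv_comp_apply {E : Type*} [NormedAddCommGroup E] [NormedSpace ℝ E] {F : E → E3}
    {x : E} (h : DifferentiableAt ℝ F x) (i : Fin 3) (v : E) :
    fderiv ℝ (fun y => F y i) x v = fderiv ℝ F x v i := by
  rw [(hasFDerivAt_comp h.hasFDerivAt i).fderiv]; rfl

theorem continuous_comp_apply {E : Type*} [TopologicalSpace E] {F : E → E3} (h : Continuous F)
    (i : Fin 3) : Continuous fun x => F x i :=
  (EuclideanSpace.proj i : E3 →L[ℝ] ℝ).continuous.comp h

/-- Second derivatives of `F` need not exist. Against a test function the divergence becomes a sum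
of integrals of `∂F ∂φ`, which cancel in pairs by the weak symmetry of mixed derivatives. -/
theorem divergence_curl {F : E3 → E3} (hF : ContDiff ℝ 1 F) (hc : ContDiff ℝ 1 (curl F)) (y : E3) :
    divergence (curl F) y = 0 := by
  have hFd := hF.differentiable (by simp)
  have hcd := hc.differentiable (by simp)
  have hF' : ∀ v i, Continuous fun x => fderiv ℝ (fun y => F y i) x v := by
    intro v i
    simp only [fun x => fderiv_comp_apply (hFd x) i v]
    exact continuous_comp_apply ((hF.continuous_fderiv (by simp)).clm_apply continuous_const) i
  have hc' : ∀ v i, Continuous fun x => fderiv ℝ (fun y => curl F y i) x v := by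
    intro v i
    simp only [fun x => fderiv_comp_apply (hcd x) i v]
    exact continuous_comp_apply ((hc.continuous_fderiv (by simp)).clm_apply continuous_const) i
  have hFi : ∀ i, Differentiable ℝ fun y => F y i :=
    fun i x => (hasFDerivAt_comp (hFd x).hasFDerivAt i).differentiableAt
  have hci : ∀ i, Differentiable ℝ fun y => curl F y i :=
    fun i x => (hasFDerivAt_comp (hcd x).hasFDerivAt i).differentiableAt
  have hdiv : divergence (curl F) =
      fun y => ∑ i, fderiv ℝ (fun z => curl F z i) y (e3 i) := by
    funext y
    simp only [divergence, partialComp, fun i => fderiv_comp_apply (hcd y) i]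
  rw [hdiv]
  refine eq_zero_of_forall_integral_smooth_mul volume
    (continuous_finsetSum _ fun i _ => hc' (e3 i) i) (fun φ hφ hφc => ?_) y
  have hφ2 : ContDiff ℝ 2 φ := contDiff_infty.1 hφ 2
  have hφ1 : ContDiff ℝ 1 φ := contDiff_infty.1 hφ 1
  have hφ' : ∀ v, Continuous fun x => fderiv ℝ φ x v := fun v =>
    (hφ1.continuous_fderiv (by simp)).clm_apply continuous_const
  have hcφ' : ∀ v, HasCompactSupport fun x => fderiv ℝ φ x v :=
    fun v => hφc.fderiv_apply (𝕜 := ℝ) v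
  have hint : ∀ v i w, Integrable fun x => fderiv ℝ (fun y => F y i) x v * fderiv ℝ φ x w :=
    fun v i w => ((hF' v i).mul (hφ' w)).integrable_of_hasCompactSupport (hcφ' w).mul_left
  have key : ∀ i, ∫ x, φ x * fderiv ℝ (fun z => curl F z i) x (e3 i) =
      (∫ x, fderiv ℝ (fun y => F y (i + 1)) x (e3 (i + 2)) * fderiv ℝ φ x (e3 i)) -
      ∫ x, fderiv ℝ (fun y => F y (i + 2)) x (e3 (i + 1)) * fderiv ℝ φ x (e3 i) := by
    intro i
    have h1 := integral_mul_fderiv_eq_neg_of_hasCompactSupport volume (hci i) (hc' (e3 i) i) hφ1 hφc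
    simp only [mul_comm (φ _)]
    rw [← neg_eq_iff_eq_neg.2 h1, ← integral_sub (hint _ _ _) (hint _ _ _), ← integral_neg]
    congr 1
    funext x
    rw [curl_apply, partialComp, partialComp, fderiv_comp_apply (hFd x), fderiv_comp_apply (hFd x)]
    ring
  simp only [Finset.mul_sum]
  rw [integral_finsetSum]
  · simp only [key, Fin.sum_univ_three]
    have hcomm : ∀ i v w, ∫ x, fderiv ℝ (fun y => F y i) x v * fderiv ℝ φ x w =
        ∫ x, fderiv ℝ (fun y => F y i) x w * fderiv ℝ φ x v := fun i v w =>
      integral_fderiv_mul_fderiv_comm volume (hFi i) (hF' v i) (hF' w i) hφ2 hφc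
    have e1 := hcomm 0 (e3 1) (e3 2)
    have e2 := hcomm 1 (e3 2) (e3 0)
    have e3' := hcomm 2 (e3 0) (e3 1)
    simp only [show (0 : Fin 3) + 1 = 1 from rfl, show (0 : Fin 3) + 2 = 2 from rfl,
      show (1 : Fin 3) + 1 = 2 from rfl, show (1 : Fin 3) + 2 = 0 from rfl,
      show (2 : Fin 3) + 1 = 0 from rfl, show (2 : Fin 3) + 2 = 1 from rfl]
    linarith
  · exact fun i _ => (hφ.continuous.mul (hc' _ _)).integrable_of_hasCompactSupport hφc.mul_right

end Curl

/-! ### The vorticity equation -/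

section Vorticity

variable {a b : ℝ} {V : E3 → ℝ → E3} {P : E3 → ℝ → ℝ}

theorem hasFDerivAt_slice_space (hv : ContDiff ℝ 1 (uncurry V)) (y : E3) (s : ℝ) :
    HasFDerivAt (fun z => V z s)
      ((fderiv ℝ (uncurry V) (y, s)).comp (ContinuousLinearMap.inl ℝ E3 ℝ)) y :=
  ((hv.differentiable (by simp) (y, s)).hasFDerivAt).comp (f := fun z : E3 => (z, s)) y
    (hasFDerivAt_prodMk_left y s)

theorem fderiv_slice_space (hv : ContDiff ℝ 1 (uncurry V)) (y : E3) (s : ℝ) (h : E3) :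
    fderiv ℝ (fun z => V z s) y h = fderiv ℝ (uncurry V) (y, s) (h, 0) := by
  rw [(hasFDerivAt_slice_space hv y s).fderiv]; rfl

theorem deriv_slice_time (hv : ContDiff ℝ 1 (uncurry V)) (y : E3) (s : ℝ) :
    deriv (V y) s = fderiv ℝ (uncurry V) (y, s) (0, 1) := by
  have := ((hv.differentiable (by simp) (y, s)).hasFDerivAt).comp (f := fun t : ℝ => (y, t)) s
    (hasFDerivAt_prodMk_right y s)
  have h2 := this.hasDerivAt.deriv
  simpa using! h2

/-- The vorticity in space-time. -/
noncomputable def vorticity (V : E3 → ℝ → E3) (p : E3 × ℝ) : E3 := curl (fun y => V y p.2) p.1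

theorem vorticity_apply (hv : ContDiff ℝ 1 (uncurry V)) (p : E3 × ℝ) (i : Fin 3) :
    vorticity V p i = fderiv ℝ (uncurry V) p (e3 (i + 1), 0) (i + 2)
      - fderiv ℝ (uncurry V) p (e3 (i + 2), 0) (i + 1) := by
  rw [vorticity, curl_apply, partialComp, partialComp, fderiv_slice_space hv, fderiv_slice_space hv]

/-- The field `(a - b) V + ω × (b y + V)`, by components. -/
noncomputable def lambField (a b : ℝ) (V : E3 → ℝ → E3) (k : Fin 3) (p : E3 × ℝ) : ℝ :=
  (a - b) * uncurry V p k
    + (vorticity V p (k + 1) * (b • p.1 + uncurry V p) (k + 2)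
      - vorticity V p (k + 2) * (b • p.1 + uncurry V p) (k + 1))

/-- `(A - Aᵀ) u` is the cross product of `u` with the curl of `A`. -/
theorem linear_sub_transpose_apply (A : E3 →L[ℝ] E3) (u : E3) (k : Fin 3) :
    A u k - ⟪u, A (e3 k)⟫ =
      (A (e3 (k + 2)) k - A (e3 k) (k + 2)) * u (k + 2)
      - (A (e3 k) (k + 1) - A (e3 (k + 1)) k) * u (k + 1) := by
  conv_lhs => rw [sum_smul_e3 u]
  simp only [map_add, map_smul, inner_eq_sum, PiLp.add_apply, PiLp.smul_apply, smul_eq_mul]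
  fin_cases k <;> simp [Fin.isValue] <;> ring_nf

/-- Adding `|V|²/2 + b ⟨y, V⟩` to the pressure turns `DV (b y + V)` into `(DV - DVᵀ)(b y + V)`, a
cross product with the vorticity. The extra `b V` from the gradient of `b ⟨y, V⟩` changes `a` to `a
- b`. -/
theorem fderiv_totalPressure (hv : ContDiff ℝ 1 (uncurry V))
    (hsol : IsSelfSimilarEulerSolution a b V P) (s : ℝ) (y : E3) :
    DifferentiableAt ℝ (fun z => P z s + (1 / 2) * ‖V z s‖ ^ 2 + b * ⟪z, V z s⟫) y ∧ ∀ k,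
      fderiv ℝ (fun z => P z s + (1 / 2) * ‖V z s‖ ^ 2 + b * ⟪z, V z s⟫) y (e3 k) =
        -(fderiv ℝ (uncurry V) (y, s) (0, 1) k + lambField a b V k (y, s)) := by
  have hP := (hsol.differentiable_pressure s y).hasFDerivAt
  have hV := hasFDerivAt_slice_space hv y s
  have hd := (hP.add ((hV.norm_sq).const_mul (1 / 2 : ℝ))).add
    (((hasFDerivAt_id y).inner ℝ hV).const_mul b)
  refine ⟨hd.differentiableAt, fun k => ?_⟩
  have hm := congr_arg (fun x : E3 => x k) (hsol.momentum y s)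
  have hg : gradient (fun z => P z s) y k = fderiv ℝ (fun z => P z s) y (e3 k) := by
    rw [gradient, ← InnerProductSpace.toDual_symm_apply (𝕜 := ℝ) (x := e3 k),
      EuclideanSpace.inner_single_right]
    simp
  have hA := linear_sub_transpose_apply
    ((fderiv ℝ (uncurry V) (y, s)).comp (ContinuousLinearMap.inl ℝ E3 ℝ)) (b • y + V y s) k
  refine (congr_arg (fun l => l (e3 k)) hd.fderiv).trans ?_
  simp only [PiLp.add_apply, PiLp.neg_apply, PiLp.smul_apply, smul_eq_mul, hg,
    deriv_slice_time hv, fderiv_slice_space hv] at hm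
  simp only [ContinuousLinearMap.coe_comp, Function.comp, ContinuousLinearMap.inl_apply] at hA
  have hlin : fderiv ℝ (uncurry V) (y, s) (b • y + V y s, 0) =
      b • fderiv ℝ (uncurry V) (y, s) (y, 0) + fderiv ℝ (uncurry V) (y, s) (V y s, 0) := by
    rw [← map_smul, ← map_add]; simp
  simp only [hlin, inner_add_left, inner_smul_left, PiLp.add_apply, PiLp.smul_apply, smul_eq_mul,
    conj_trivial] at hA
  simp only [lambField, vorticity_apply hv, uncurry, PiLp.add_apply, PiLp.smul_apply, smul_eq_mul]
  have hin : ⟪e3 k, V y s⟫ = V y s k := by simp [EuclideanSpace.inner_single_left]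
  simp only [add_apply, smul_apply, ContinuousLinearMap.coe_comp, Function.comp,
    ContinuousLinearMap.inl_apply, smul_eq_mul, innerSL_apply_apply, fderivInnerCLM_apply,
    ContinuousLinearMap.prod_apply, ContinuousLinearMap.id_apply, hin, nsmul_eq_mul, id]
  push_cast
  have e1 : k + 1 + 1 = k + 2 := by rw [add_assoc]; rfl
  have e2 : k + 1 + 2 = k := by rw [add_assoc]; simp
  have e3 : k + 2 + 1 = k := by rw [add_assoc]; simp
  have e4 : k + 2 + 2 = k + 1 := by rw [add_assoc]; rfl
  simp only [e1, e2, e3, e4]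
  linarith

theorem continuous_fderiv_apply {E : Type*} [NormedAddCommGroup E] [NormedSpace ℝ E]
    {F : Type*} [NormedAddCommGroup F] [NormedSpace ℝ F] {f : E → F} (hf : ContDiff ℝ 1 f) (v : E) :
    Continuous fun x => fderiv ℝ f x v :=
  (hf.continuous_fderiv (by simp)).clm_apply continuous_const

theorem contDiff_comp_apply {E : Type*} [NormedAddCommGroup E] [NormedSpace ℝ E] {n : ℕ∞}
    {F : E → E3} (hF : ContDiff ℝ n F) (i : Fin 3) : ContDiff ℝ n fun x => F x i :=
  (EuclideanSpace.proj i : E3 →L[ℝ] ℝ).contDiff.comp hF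

theorem contDiff_lambField (a b : ℝ) (hv : ContDiff ℝ 1 (uncurry V))
    (hw : ContDiff ℝ 1 (vorticity V)) (k : Fin 3) : ContDiff ℝ 1 (lambField a b V k) := by
  have h1 := fun i => contDiff_comp_apply (n := 1) hv i
  have h2 := fun i => contDiff_comp_apply (n := 1) hw i
  have h3 := fun i => contDiff_comp_apply (n := 1)
    ((contDiff_fst.const_smul b).add hv : ContDiff ℝ 1 fun p : E3 × ℝ => b • p.1 + uncurry V p) i
  exact (contDiff_const.mul (h1 k)).add (((h2 _).mul (h3 _)).sub ((h2 _).mul (h3 _)))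

/-- Says weakly that `∂ₛV` plus the Lamb field is curl free in space, being a gradient. The argument
runs on each time slice, since nothing is known about the pressure in `s`; its gradient is
continuous on a slice by the momentum equation. -/
theorem integral_totalPressure_comm (hv : ContDiff ℝ 1 (uncurry V))
    (hw : ContDiff ℝ 1 (vorticity V)) (hsol : IsSelfSimilarEulerSolution a b V P)
    {φ : E3 × ℝ → ℝ} (hφ : ContDiff ℝ ∞ φ) (hc : HasCompactSupport φ) (j k : Fin 3) :
    ∫ p, (fderiv ℝ (uncurry V) p (0, 1) k + lambField a b V k p) * fderiv ℝ φ p (e3 j, 0)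
        ∂((volume : Measure E3).prod (volume : Measure ℝ)) =
      ∫ p, (fderiv ℝ (uncurry V) p (0, 1) j + lambField a b V j p) * fderiv ℝ φ p (e3 k, 0)
        ∂((volume : Measure E3).prod (volume : Measure ℝ)) := by
  have hφ1 : ContDiff ℝ 1 φ := contDiff_infty.1 hφ 1
  have hq : ∀ k, Continuous fun p => fderiv ℝ (uncurry V) p (0, 1) k + lambField a b V k p :=
    fun k => (continuous_comp_apply (continuous_fderiv_apply hv _) k).add
      (contDiff_lambField a b hv hw k).continuous
  have hint : ∀ j k, Integrable (fun p => (fderiv ℝ (uncurry V) p (0, 1) k + lambField a b V k p) *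
      fderiv ℝ φ p (e3 j, 0)) ((volume : Measure E3).prod (volume : Measure ℝ)) := fun j k =>
    ((hq k).mul (continuous_fderiv_apply hφ1 _)).integrable_of_hasCompactSupport
      (hc.fderiv_apply (𝕜 := ℝ) _).mul_left
  rw [integral_prod_symm _ (hint j k), integral_prod_symm _ (hint k j)]
  congr 1
  funext s
  have hQ := fderiv_totalPressure hv hsol s
  have hφs : ContDiff ℝ ∞ fun y => φ (y, s) := hφ.comp (contDiff_id.prodMk contDiff_const)
  have hcs : HasCompactSupport fun y => φ (y, s) :=
    hc.comp_isClosedEmbedding ⟨isEmbedding_prodMkLeft s, by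
      convert (isClosed_singleton (x := s)).preimage (continuous_snd : Continuous (Prod.snd : E3 × ℝ → ℝ))
      ext ⟨y, t⟩; simp [eq_comm]⟩
  have hd : ∀ y h, fderiv ℝ (fun y => φ (y, s)) y h = fderiv ℝ φ (y, s) (h, 0) := by
    intro y h
    have := ((hφ1.differentiable (by simp) (y, s)).hasFDerivAt).comp (f := fun z : E3 => (z, s)) y
      (hasFDerivAt_prodMk_left y s)
    exact congr_arg (fun l => l h) this.fderiv
  have hcont : ∀ k, Continuous fun y : E3 => fderiv ℝ
      (fun z => P z s + (1 / 2) * ‖V z s‖ ^ 2 + b * ⟪z, V z s⟫) y (e3 k) := by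
    intro k
    simp only [fun y => (hQ y).2 k]
    exact ((hq k).comp (by fun_prop : Continuous fun y : E3 => (y, s))).neg
  have hcomm := integral_fderiv_mul_fderiv_comm volume (fun y => (hQ y).1) (hcont k) (hcont j)
    (contDiff_infty.1 hφs 2) hcs
  simpa only [fun y k => (hQ y).2 k, hd, neg_mul, integral_neg, neg_inj] using hcomm

/-- The curl of the momentum equation. -/
theorem curl_momentum (hv : ContDiff ℝ 1 (uncurry V))
    (hw : ContDiff ℝ 1 (vorticity V)) (hsol : IsSelfSimilarEulerSolution a b V P)
    (i : Fin 3) (p : E3 × ℝ) :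
    fderiv ℝ (fun p => vorticity V p i) p (0, 1)
      + fderiv ℝ (lambField a b V (i + 2)) p (e3 (i + 1), 0)
      - fderiv ℝ (lambField a b V (i + 1)) p (e3 (i + 2), 0) = 0 := by
  set μ : Measure (E3 × ℝ) := (volume : Measure E3).prod (volume : Measure ℝ)
  have hG := contDiff_lambField a b hv hw
  have hwi := contDiff_comp_apply (n := 1) hw i
  have hvi := contDiff_comp_apply (n := 1) hv
  refine eq_zero_of_forall_integral_smooth_mul μ (((continuous_fderiv_apply hwi _).add
    (continuous_fderiv_apply (hG _) _)).sub (continuous_fderiv_apply (hG _) _))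
    (fun φ hφ hc => ?_) p
  have hφ1 : ContDiff ℝ 1 φ := contDiff_infty.1 hφ 1
  have hφ2 : ContDiff ℝ 2 φ := contDiff_infty.1 hφ 2
  have hI : ∀ {f : E3 × ℝ → ℝ} (_ : Continuous f), Integrable (fun p => f p * φ p) μ :=
    fun hf => (hf.mul hφ.continuous).integrable_of_hasCompactSupport hc.mul_left
  have hI' : ∀ {f : E3 × ℝ → ℝ} (_ : Continuous f) (v : E3 × ℝ),
      Integrable (fun p => f p * fderiv ℝ φ p v) μ := fun hf v =>
    (hf.mul (continuous_fderiv_apply hφ1 v)).integrable_of_hasCompactSupport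
      (hc.fderiv_apply (𝕜 := ℝ) v).mul_left
  have hparts : ∀ {f : E3 × ℝ → ℝ} (_ : ContDiff ℝ 1 f) (v : E3 × ℝ),
      ∫ p, fderiv ℝ f p v * φ p ∂μ = - ∫ p, f p * fderiv ℝ φ p v ∂μ := fun hf v => by
    rw [integral_mul_fderiv_eq_neg_of_hasCompactSupport μ (hf.differentiable (by simp))
      (continuous_fderiv_apply hf v) hφ1 hc, neg_neg]
  have hcomm : ∀ k v w, ∫ p, fderiv ℝ (uncurry V) p v k * fderiv ℝ φ p w ∂μ =
      ∫ p, fderiv ℝ (uncurry V) p w k * fderiv ℝ φ p v ∂μ := fun k v w => by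
    have := integral_fderiv_mul_fderiv_comm μ ((hvi k).differentiable (by simp))
      (continuous_fderiv_apply (hvi k) v) (continuous_fderiv_apply (hvi k) w) hφ2 hc
    simpa only [fun x v => fderiv_comp_apply (hv.differentiable (by simp) x) k v] using this
  have hVc : ∀ v k, Continuous fun p => fderiv ℝ (uncurry V) p v k :=
    fun v k => continuous_comp_apply (continuous_fderiv_apply hv v) k
  have e : ∀ p, φ p * (fderiv ℝ (fun p => vorticity V p i) p (0, 1)
      + fderiv ℝ (lambField a b V (i + 2)) p (e3 (i + 1), 0)
      - fderiv ℝ (lambField a b V (i + 1)) p (e3 (i + 2), 0)) =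
      fderiv ℝ (fun p => vorticity V p i) p (0, 1) * φ p
      + fderiv ℝ (lambField a b V (i + 2)) p (e3 (i + 1), 0) * φ p
      - fderiv ℝ (lambField a b V (i + 1)) p (e3 (i + 2), 0) * φ p := fun p => by ring
  simp only [Pi.add_apply, Pi.sub_apply, e]
  have hsum : Integrable (fun p => fderiv ℝ (fun p => vorticity V p i) p (0, 1) * φ p
      + fderiv ℝ (lambField a b V (i + 2)) p (e3 (i + 1), 0) * φ p) μ :=
    (hI (continuous_fderiv_apply hwi _)).add (hI (continuous_fderiv_apply (hG _) _))
  rw [integral_sub hsum (hI (continuous_fderiv_apply (hG _) _)),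
    integral_add (hI (continuous_fderiv_apply hwi _)) (hI (continuous_fderiv_apply (hG _) _)),
    hparts hwi, hparts (hG _), hparts (hG _)]
  have hQ := integral_totalPressure_comm hv hw hsol hφ hc (i + 1) (i + 2)
  simp only [add_mul] at hQ
  rw [integral_add (hI' (hVc _ _) _) (hI' (hG _).continuous _),
    integral_add (hI' (hVc _ _) _) (hI' (hG _).continuous _)] at hQ
  -- The time derivative and the curl are exchanged by the weak symmetry of space-time derivatives
  -- of `V`.
  have hω : ∫ p, vorticity V p i * fderiv ℝ φ p (0, 1) ∂μ =
      (∫ p, fderiv ℝ (uncurry V) p (0, 1) (i + 2) * fderiv ℝ φ p (e3 (i + 1), 0) ∂μ)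
      - ∫ p, fderiv ℝ (uncurry V) p (0, 1) (i + 1) * fderiv ℝ φ p (e3 (i + 2), 0) ∂μ := by
    rw [hcomm, hcomm (i + 1), ← integral_sub (hI' (hVc _ _) _) (hI' (hVc _ _) _)]
    simp only [vorticity_apply hv, sub_mul]
  rw [hω]
  linarith

theorem divergence_vorticity (hv : ContDiff ℝ 1 (uncurry V)) (hw : ContDiff ℝ 1 (vorticity V))
    (p : E3 × ℝ) : ∑ i, fderiv ℝ (vorticity V) p (e3 i, 0) i = 0 := by
  have hs : ∀ s : ℝ, ContDiff ℝ 1 fun y : E3 => (y, s) := fun s => contDiff_id.prodMk contDiff_const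
  have h := divergence_curl (F := fun y => V y p.2) (hv.comp (hs p.2)) (hw.comp (hs p.2)) p.1
  refine Eq.trans ?_ h
  simp only [divergence, partialComp]
  refine Finset.sum_congr rfl fun i _ => ?_
  have := ((hw.differentiable (by simp) p).hasFDerivAt).comp (f := fun z : E3 => (z, p.2)) p.1
    (hasFDerivAt_prodMk_left p.1 p.2)
  exact (congr_arg (fun l => l (e3 i) i) this.fderiv).symm

theorem fderiv_lambField (a b : ℝ) (hv : ContDiff ℝ 1 (uncurry V)) (hw : ContDiff ℝ 1 (vorticity V))
    (k : Fin 3) (p : E3 × ℝ) (h : E3) :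
    fderiv ℝ (lambField a b V k) p (h, 0) =
      (a - b) * fderiv ℝ (uncurry V) p (h, 0) k
      + (vorticity V p (k + 1) * (b * h (k + 2) + fderiv ℝ (uncurry V) p (h, 0) (k + 2))
        + (b • p.1 + uncurry V p) (k + 2) * fderiv ℝ (vorticity V) p (h, 0) (k + 1)
        - (vorticity V p (k + 2) * (b * h (k + 1) + fderiv ℝ (uncurry V) p (h, 0) (k + 1))
        + (b • p.1 + uncurry V p) (k + 1) * fderiv ℝ (vorticity V) p (h, 0) (k + 2))) := by
  have h1 := hasFDerivAt_comp (hv.differentiable (by simp) p).hasFDerivAt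
  have h2 := hasFDerivAt_comp (hw.differentiable (by simp) p).hasFDerivAt
  have h3 := hasFDerivAt_comp (((hasFDerivAt_fst (𝕜 := ℝ) (p := p)).const_smul b).add
    (hv.differentiable (by simp) p).hasFDerivAt)
  have := ((h1 k).const_mul (a - b)).add
    (((h2 (k + 1)).mul (h3 (k + 2))).sub ((h2 (k + 2)).mul (h3 (k + 1))))
  refine (congr_arg (fun l => l (h, 0)) this.fderiv).trans ?_
  simp
  ring

/-- The vorticity equation. -/
theorem vorticity_equation (hv : ContDiff ℝ 1 (uncurry V))
    (hw : ContDiff ℝ 1 (vorticity V)) (hsol : IsSelfSimilarEulerSolution a b V P)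
    (p : E3 × ℝ) :
    fderiv ℝ (vorticity V) p (b • p.1 + uncurry V p, 1) =
      -(a + b) • vorticity V p + fderiv ℝ (uncurry V) p (vorticity V p, 0) := by
  have hdw := divergence_vorticity hv hw p
  have hdv := hsol.incompressible p.1 p.2
  simp only [divergence, partialComp, fderiv_slice_space hv, Fin.sum_univ_three] at hdv hdw
  have hexp : ∀ (A : E3 × ℝ →L[ℝ] E3) (u : E3) (t : ℝ), A (u, t) =
      u 0 • A (e3 0, 0) + u 1 • A (e3 1, 0) + u 2 • A (e3 2, 0) + t • A (0, 1) := by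
    intro A u t
    conv_lhs => rw [show (u, t) = u 0 • (e3 0, (0 : ℝ)) + u 1 • (e3 1, (0 : ℝ))
      + u 2 • (e3 2, (0 : ℝ)) + t • ((0 : E3), (1 : ℝ)) by
        ext1
        · simpa using sum_smul_e3 u
        · simp]
    simp only [map_add, map_smul]
  ext i
  have hm := curl_momentum hv hw hsol i p
  have hωi := vorticity_apply hv p
  rw [fderiv_comp_apply (hw.differentiable (by simp) p), fderiv_lambField a b hv hw,
    fderiv_lambField a b hv hw] at hm
  rw [hexp _ (b • p.1 + uncurry V p), hexp _ (vorticity V p)]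
  have hω0 := hωi 0
  have hω1 := hωi 1
  have hω2 := hωi 2
  simp only [show (0 : Fin 3) + 1 = 1 from rfl, show (0 : Fin 3) + 2 = 2 from rfl,
      show (1 : Fin 3) + 1 = 2 from rfl, show (1 : Fin 3) + 2 = 0 from rfl,
      show (2 : Fin 3) + 1 = 0 from rfl, show (2 : Fin 3) + 2 = 1 from rfl] at hω0 hω1 hω2
  simp only [PiLp.add_apply, PiLp.smul_apply, smul_eq_mul] at hm ⊢
  generalize fderiv ℝ (uncurry V) p = D at *
  generalize fderiv ℝ (vorticity V) p = W at *
  generalize uncurry V p = v at *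
  generalize vorticity V p = w at *
  fin_cases i <;> simp [e3] at hm hdv hdw hω0 hω1 hω2 ⊢
  -- This is `curl (ω × u) = (u · ∇)ω - (ω · ∇)u + ω div u - u div ω` with `u = b y + V`. Here `div
  -- u = 3b` and `(ω · ∇)u = b ω + (ω · ∇)V`, so the coefficient of `ω` is `(a - b) + 3b - b = a +
  -- b`.
  · linear_combination hm + (b * p.1 0 + v 0) * hdw + (a - b) * hω0 - w 0 * hdv
  · linear_combination hm + (b * p.1 1 + v 1) * hdw + (a - b) * hω1 - w 1 * hdv
  · linear_combination hm + (b * p.1 2 + v 2) * hdw + (a - b) * hω2 - w 2 * hdv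

end Vorticity

/-! ### Weights supported in a ball -/

section Weight

theorem hasDerivAt_max_zero_pow (n : ℕ) (x : ℝ) :
    HasDerivAt (fun x : ℝ => max x 0 ^ (n + 2)) ((n + 2 : ℝ) * max x 0 ^ (n + 1)) x := by
  have hne : ∀ x : ℝ, x ≠ 0 →
      HasDerivAt (fun x : ℝ => max x 0 ^ (n + 2)) ((n + 2 : ℝ) * max x 0 ^ (n + 1)) x := by
    intro x hx
    rcases lt_or_gt_of_ne hx with h | h
    · rw [max_eq_right h.le, zero_pow (by omega), mul_zero]
      refine (hasDerivAt_const x (0 : ℝ)).congr_of_eventuallyEq ?_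
      filter_upwards [gt_mem_nhds h] with z hz
      rw [max_eq_right (le_of_lt hz), zero_pow (by omega)]
    · rw [max_eq_left h.le]
      have := hasDerivAt_pow (n + 2) x
      refine (by simpa using this : HasDerivAt _ _ x).congr_of_eventuallyEq ?_
      filter_upwards [lt_mem_nhds h] with z hz
      rw [max_eq_left (le_of_lt hz)]
  rcases eq_or_ne x 0 with rfl | hx
  · exact hasDerivAt_of_hasDerivAt_of_ne (fun y hy => hne y hy) (by fun_prop) (by fun_prop)
  · exact hne x hx

theorem contDiff_max_zero_pow (n : ℕ) : ContDiff ℝ n fun x : ℝ => max x 0 ^ (n + 1) := by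
  induction n with
  | zero => exact contDiff_zero.2 (by fun_prop)
  | succ n ih =>
    push_cast
    rw [contDiff_succ_iff_deriv]
    refine ⟨fun x => (hasDerivAt_max_zero_pow n x).differentiableAt, by simp, ?_⟩
    rw [funext fun x => (hasDerivAt_max_zero_pow n x).deriv]
    exact contDiff_const.mul ih

/-- The weight `(r² - |y|²)₊ⁿ` supported in the ball of radius `r`. -/
noncomputable def ballWeight (r : ℝ) (n : ℕ) (y : E3) : ℝ := max (r ^ 2 - ‖y‖ ^ 2) 0 ^ n

variable {r : ℝ} {n : ℕ}

theorem ballWeight_nonneg (y : E3) : 0 ≤ ballWeight r n y := by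
  unfold ballWeight; positivity

theorem ballWeight_eq_zero (hr : 0 ≤ r) (hn : n ≠ 0) {y : E3} (hy : r ≤ ‖y‖) :
    ballWeight r n y = 0 := by
  have : r ^ 2 ≤ ‖y‖ ^ 2 := pow_le_pow_left₀ hr hy 2
  rw [ballWeight, max_eq_right (by linarith), zero_pow hn]

theorem ballWeight_pos {y : E3} (hy : ‖y‖ < r) : 0 < ballWeight r n y := by
  have : ‖y‖ ^ 2 < r ^ 2 := pow_lt_pow_left₀ hy (norm_nonneg _) two_ne_zero
  exact pow_pos (lt_max_of_lt_left (by linarith)) _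

theorem continuous_ballWeight : Continuous (ballWeight r n) := by
  unfold ballWeight; fun_prop

theorem contDiff_ballWeight : ContDiff ℝ n (ballWeight r (n + 1)) :=
  (contDiff_max_zero_pow n).comp (contDiff_const.sub (contDiff_norm_sq ℝ))

theorem hasCompactSupport_ballWeight (hr : 0 ≤ r) (hn : n ≠ 0) :
    HasCompactSupport (ballWeight r n) :=
  HasCompactSupport.intro (isCompact_closedBall (0 : E3) r) fun y hy => by
    rw [Metric.mem_closedBall, dist_zero_right, not_le] at hy
    exact ballWeight_eq_zero hr hn hy.le

/-- The gradient is radial and lowers the exponent by one; testing against the weight therefore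
produces the radial derivative that governs dilations. -/
theorem hasFDerivAt_ballWeight (y : E3) :
    HasFDerivAt (ballWeight r (n + 2))
      ((-(2 * (n + 2 : ℝ)) * ballWeight r (n + 1) y) • innerSL ℝ y) y := by
  have h1 : HasFDerivAt (fun y : E3 => r ^ 2 - ‖y‖ ^ 2) (-(2 • innerSL ℝ y)) y := by
    simpa using ((hasFDerivAt_id y).norm_sq).const_sub (r ^ 2)
  have h2 := (hasDerivAt_max_zero_pow n (r ^ 2 - ‖y‖ ^ 2)).comp_hasFDerivAt y h1
  have h3 : HasFDerivAt (ballWeight r (n + 2)) _ y := h2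
  refine h3.congr_fderiv ?_
  ext v
  simp [ballWeight]
  ring

end Weight

/-! ### Curl and divergence free fields: weak harmonicity and moments -/

section CurlDivFree

/-- A `C¹` vector field on `ℝ³` whose curl and divergence vanish on the ball of radius `r`. -/
structure CurlDivFree (r : ℝ) (F : E3 → E3) : Prop where
  contDiff : ContDiff ℝ 1 F
  symm : ∀ y, ‖y‖ < r → ∀ i j, fderiv ℝ F y (e3 j) i = fderiv ℝ F y (e3 i) j
  trace : ∀ y, ‖y‖ < r → ∑ i, fderiv ℝ F y (e3 i) i = 0

namespace CurlDivFree

variable {r : ℝ} {F : E3 → E3}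

theorem of_curl_eq_zero (hF : ContDiff ℝ 1 F) (hc : ∀ y, ‖y‖ < r → curl F y = 0)
    (hd : ∀ y, ‖y‖ < r → divergence F y = 0) : CurlDivFree r F where
  contDiff := hF
  symm y hy i j := by
    have h0 := congr_arg (fun x : E3 => x 0) (hc y hy)
    have h1 := congr_arg (fun x : E3 => x 1) (hc y hy)
    have h2 := congr_arg (fun x : E3 => x 2) (hc y hy)
    simp [curl, partialComp, sub_eq_zero] at h0 h1 h2
    fin_cases i <;> fin_cases j <;> simp [e3, h0, h1, h2]
  trace y hy := hd y hy

theorem dilate (hF : CurlDivFree r F) {t : ℝ} (ht : t ∈ Icc (0 : ℝ) 1) :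
    CurlDivFree r fun y => F (t • y) := by
  have hd : ∀ y v, fderiv ℝ (fun y => F (t • y)) y v = t • fderiv ℝ F (t • y) v := by
    intro y v
    have := ((hF.contDiff.differentiable (by simp) (t • y)).hasFDerivAt).comp y
      ((hasFDerivAt_id y).const_smul t)
    refine (congr_arg (fun l => l v) this.fderiv).trans ?_
    simp
  have hn : ∀ y : E3, ‖y‖ < r → ‖t • y‖ < r := by
    intro y hy
    rw [norm_smul, Real.norm_of_nonneg ht.1]
    exact (mul_le_of_le_one_left (norm_nonneg _) ht.2).trans_lt hy
  refine ⟨hF.contDiff.comp (contDiff_id.const_smul t), fun y hy i j => ?_, fun y hy => ?_⟩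
  · simp only [hd, PiLp.smul_apply, hF.symm _ (hn y hy) i j]
  · simp only [hd, PiLp.smul_apply, ← Finset.smul_sum, hF.trace _ (hn y hy), smul_zero]

/-- The components of a curl and divergence free field are weakly harmonic. -/
theorem integral_fderiv_mul_fderiv (hF : CurlDivFree r F) {φ : E3 → ℝ} (hφ : ContDiff ℝ 2 φ)
    (hc : HasCompactSupport φ) (hφ0 : ∀ y, r ≤ ‖y‖ → fderiv ℝ φ y = 0) (i : Fin 3) :
    ∫ y, ∑ j, fderiv ℝ F y (e3 j) i * fderiv ℝ φ y (e3 j) = 0 := by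
  have hFd := hF.contDiff.differentiable (by simp)
  have hFc : ∀ v i, Continuous fun x => fderiv ℝ F x v i := fun v i =>
    continuous_comp_apply (continuous_fderiv_apply hF.contDiff v) i
  have hφ1 : ContDiff ℝ 1 φ := hφ.of_le (by norm_num)
  have hI : ∀ v i w, Integrable fun x => fderiv ℝ F x v i * fderiv ℝ φ x w := fun v i w =>
    ((hFc v i).mul (continuous_fderiv_apply hφ1 w)).integrable_of_hasCompactSupport
      (hc.fderiv_apply (𝕜 := ℝ) w).mul_left
  -- Symmetry of `DF` and weak exchange of derivatives turn `∂ⱼFᵢ ∂ⱼφ` into `∂ⱼFⱼ ∂ᵢφ`, whose sum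
  -- over `j` contains the trace. Outside the ball `∇φ = 0` replaces both facts.
  have hcomm : ∀ j, ∫ y, fderiv ℝ F y (e3 j) i * fderiv ℝ φ y (e3 j) =
      ∫ y, fderiv ℝ F y (e3 j) j * fderiv ℝ φ y (e3 i) := by
    intro j
    have hFj : Differentiable ℝ fun y => F y j := fun x =>
      (hasFDerivAt_comp (hFd x).hasFDerivAt j).differentiableAt
    have h := integral_fderiv_mul_fderiv_comm volume (v := e3 i) (w := e3 j) hFj
      (by simpa only [fun x v => fderiv_comp_apply (hFd x) j v] using hFc _ j)
      (by simpa only [fun x v => fderiv_comp_apply (hFd x) j v] using hFc _ j) hφ hc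
    simp only [fun x v => fderiv_comp_apply (hFd x) j v] at h
    rw [← h]
    congr 1
    funext y
    rcases lt_or_ge ‖y‖ r with hy | hy
    · rw [hF.symm y hy i j]
    · simp [hφ0 y hy]
  rw [integral_finsetSum _ fun j _ => hI _ _ _]
  simp only [hcomm]
  rw [← integral_finsetSum _ fun j _ => hI (e3 j) j (e3 i), ← integral_zero E3 ℝ (μ := volume)]
  congr 1
  funext y
  rcases lt_or_ge ‖y‖ r with hy | hy
  · rw [← Finset.sum_mul, hF.trace y hy, zero_mul]
  · simp [hφ0 y hy]

/-- Moments of a component of a field against powers of a linear form and the weight of a ball. -/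
noncomputable def moment (r : ℝ) (F : E3 → E3) (i : Fin 3) (ξ : E3) (k n : ℕ) : ℝ :=
  ∫ y, F y i * (⟪ξ, y⟫ ^ k * ballWeight r n y)

theorem hasFDerivAt_inner_pow_mul_ballWeight (ξ : E3) (k n : ℕ) (y : E3) :
    ∃ φ' : E3 →L[ℝ] ℝ, HasFDerivAt (fun y => ⟪ξ, y⟫ ^ k * ballWeight r (n + 2) y) φ' y ∧
      ∀ v, φ' v = k * ⟪ξ, y⟫ ^ (k - 1) * ballWeight r (n + 2) y * ⟪ξ, v⟫
        - 2 * (n + 2) * ⟪ξ, y⟫ ^ k * ballWeight r (n + 1) y * ⟪y, v⟫ := by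
  have h1 : HasFDerivAt (fun y => ⟪ξ, y⟫) (innerSL ℝ ξ) y := (innerSL ℝ ξ).hasFDerivAt
  refine ⟨_, (h1.pow k).mul (hasFDerivAt_ballWeight y), fun v => ?_⟩
  simp
  ring

/-- Weak harmonicity is tested with `⟨ξ, y⟩^k` times the weight of exponent `n + 3`. The derivative
of the weight gives the radial derivative of `F`, that of the power gives `∂_ξ F`, which is
integrated by parts once more. -/
theorem moment_identity (hr : 0 ≤ r) (hF : CurlDivFree r F) (i : Fin 3) (ξ : E3) (k n : ℕ) :
    ∫ y, fderiv ℝ F y y i * (⟪ξ, y⟫ ^ k * ballWeight r (n + 2) y) =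
      k * moment r F i ξ k (n + 2)
      - k * (k - 1) * ‖ξ‖ ^ 2 / (2 * (n + 3)) * moment r F i ξ (k - 2) (n + 3) := by
  have hFd := hF.contDiff.differentiable (by simp)
  have hFc : ∀ v, Continuous fun x => fderiv ℝ F x v i := fun v =>
    continuous_comp_apply (continuous_fderiv_apply hF.contDiff v) i
  have hFc' : Continuous fun x => fderiv ℝ F x x i :=
    continuous_comp_apply ((hF.contDiff.continuous_fderiv (by simp)).clm_apply continuous_id) i
  have hFi : Continuous fun x => F x i := continuous_comp_apply hF.contDiff.continuous i
  have hFid : Differentiable ℝ fun x => F x i :=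
    fun x => (hasFDerivAt_comp (hFd x).hasFDerivAt i).differentiableAt
  have hw : ∀ k n, ContDiff ℝ 2 fun y : E3 => ⟪ξ, y⟫ ^ k * ballWeight r (n + 3) y := fun k n =>
    (((innerSL ℝ ξ).contDiff (n := 2)).pow k).mul
      ((contDiff_ballWeight (n := n + 2)).of_le (by norm_cast; omega))
  have hc : ∀ k n, HasCompactSupport fun y : E3 => ⟪ξ, y⟫ ^ k * ballWeight r (n + 1) y :=
    fun k n => (hasCompactSupport_ballWeight hr (by omega)).mul_left
  have hIm : ∀ {f : E3 → ℝ} (_ : Continuous f) (k n : ℕ),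
      Integrable fun y => f y * (⟪ξ, y⟫ ^ k * ballWeight r (n + 1) y) := by
    intro f hf k n
    refine Continuous.integrable_of_hasCompactSupport ?_ (hc k n).mul_left
    have := continuous_ballWeight (r := r) (n := n + 1)
    fun_prop
  have hzero : ∀ y, r ≤ ‖y‖ →
      fderiv ℝ (fun y => ⟪ξ, y⟫ ^ k * ballWeight r (n + 3) y) y = 0 := by
    intro y hy
    obtain ⟨φ', h1, h2⟩ := hasFDerivAt_inner_pow_mul_ballWeight (r := r) ξ k (n + 1) y
    rw [h1.fderiv]
    ext v
    rw [h2, ballWeight_eq_zero hr (by omega) hy, ballWeight_eq_zero hr (by omega) hy]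
    simp
  have hweak := hF.integral_fderiv_mul_fderiv (hw k n) (hc k (n + 2)) hzero i
  have hsum : ∀ y, ∑ j, fderiv ℝ F y (e3 j) i *
        fderiv ℝ (fun y => ⟪ξ, y⟫ ^ k * ballWeight r (n + 3) y) y (e3 j) =
      k * (fderiv ℝ F y ξ i * (⟪ξ, y⟫ ^ (k - 1) * ballWeight r (n + 3) y))
      - 2 * (n + 3) * (fderiv ℝ F y y i * (⟪ξ, y⟫ ^ k * ballWeight r (n + 2) y)) := by
    intro y
    obtain ⟨φ', h1, h2⟩ := hasFDerivAt_inner_pow_mul_ballWeight (r := r) ξ k (n + 1) y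
    have hlin : ∀ u : E3, fderiv ℝ F y u i = u 0 * fderiv ℝ F y (e3 0) i
        + u 1 * fderiv ℝ F y (e3 1) i + u 2 * fderiv ℝ F y (e3 2) i := by
      intro u
      conv_lhs => rw [sum_smul_e3 u]
      simp
    have hin : ∀ (u : E3) (j : Fin 3), ⟪u, e3 j⟫ = u j := fun u j => by
      rw [EuclideanSpace.inner_single_right]; simp
    rw [h1.fderiv, hlin ξ, hlin y]
    simp only [h2, hin, Fin.sum_univ_three]
    push_cast
    ring
  simp only [hsum] at hweak
  rw [integral_sub ((hIm (hFc ξ) (k - 1) (n + 2)).const_mul _)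
    ((hIm hFc' k (n + 1)).const_mul _), integral_const_mul, integral_const_mul] at hweak
  have hn : (0 : ℝ) < 2 * (n + 3) := by positivity
  have hmain : (k : ℝ) * ∫ y, fderiv ℝ F y ξ i * (⟪ξ, y⟫ ^ (k - 1) * ballWeight r (n + 3) y) =
      2 * (n + 3) * (k * moment r F i ξ k (n + 2))
      - k * (k - 1) * ‖ξ‖ ^ 2 * moment r F i ξ (k - 2) (n + 3) := by
    -- For `k = 0` both sides vanish. The truncated exponents `k - 1` and `k - 2` are harmless
    -- because their coefficients vanish exactly when truncation occurs.
    rcases k with _ | k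
    · simp
    have hp := integral_mul_fderiv_eq_neg_of_hasCompactSupport volume (v := ξ) hFid
      (by simpa only [fun x v => fderiv_comp_apply (hFd x) i v] using hFc ξ)
      ((hw k n).of_le (by norm_num)) (hc k (n + 2))
    simp only [fun x v => fderiv_comp_apply (hFd x) i v] at hp
    have hg : ∀ y, F y i * fderiv ℝ (fun y => ⟪ξ, y⟫ ^ k * ballWeight r (n + 3) y) y ξ =
        k * ‖ξ‖ ^ 2 * (F y i * (⟪ξ, y⟫ ^ (k - 1) * ballWeight r (n + 3) y))
        - 2 * (n + 3) * (F y i * (⟪ξ, y⟫ ^ (k + 1) * ballWeight r (n + 2) y)) := by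
      intro y
      obtain ⟨φ', h1, h2⟩ := hasFDerivAt_inner_pow_mul_ballWeight (r := r) ξ k (n + 1) y
      rw [h1.fderiv, h2, real_inner_self_eq_norm_sq, real_inner_comm ξ y]
      push_cast
      ring
    simp only [hg] at hp
    rw [integral_sub ((hIm hFi (k - 1) (n + 2)).const_mul _)
      ((hIm hFi (k + 1) (n + 1)).const_mul _), integral_const_mul, integral_const_mul] at hp
    simp only [moment, Nat.add_sub_cancel, show k + 1 - 2 = k - 1 by omega]
    push_cast
    linear_combination (k + 1 : ℝ) * hp
  have hlast : 2 * (n + 3) * (∫ y, fderiv ℝ F y y i * (⟪ξ, y⟫ ^ k * ballWeight r (n + 2) y)) =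
      2 * (n + 3) * (k * moment r F i ξ k (n + 2))
      - k * (k - 1) * ‖ξ‖ ^ 2 * moment r F i ξ (k - 2) (n + 3) := by
    rw [← hmain]
    exact (sub_eq_zero.1 hweak).symm
  generalize (∫ y, fderiv ℝ F y y i * (⟪ξ, y⟫ ^ k * ballWeight r (n + 2) y)) = I at hlast ⊢
  field_simp
  linarith

end CurlDivFree
end CurlDivFree

/-! ### Dilations: mean value property and vanishing of moments -/

namespace CurlDivFree

variable {r : ℝ} {F : E3 → E3}

theorem hasDerivAt_moment_dilate (hr : 0 ≤ r) (hF : CurlDivFree r F) (i : Fin 3) (ξ : E3) (k n : ℕ)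
    (t : ℝ) :
    HasDerivAt (fun t : ℝ => moment r (fun y => F (t • y)) i ξ k (n + 1))
      (∫ y, fderiv ℝ F (t • y) y i * (⟪ξ, y⟫ ^ k * ballWeight r (n + 1) y)) t := by
  have hFc := hF.contDiff.continuous
  have hF'c : Continuous fun p : ℝ × E3 => fderiv ℝ F (p.1 • p.2) p.2 :=
    ((hF.contDiff.continuous_fderiv (by simp)).comp (by fun_prop)).clm_apply continuous_snd
  have hw := continuous_ballWeight (r := r) (n := n + 1)
  have hwc : HasCompactSupport (ballWeight r (n + 1)) := hasCompactSupport_ballWeight hr (by omega)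
  have hg : Continuous fun p : ℝ × E3 => fderiv ℝ F (p.1 • p.2) p.2 i *
      (⟪ξ, p.2⟫ ^ k * ballWeight r (n + 1) p.2) := by
    have := continuous_comp_apply hF'c i
    fun_prop
  -- A dominating constant on the closed ball, locally uniform in `t`; outside, the weight is zero.
  obtain ⟨C, hC⟩ := ((isCompact_Icc (a := t - 1) (b := t + 1)).prod
    (isCompact_closedBall (0 : E3) r)).exists_bound_of_continuousOn hg.continuousOn
  have hm : ∀ t : ℝ, Continuous fun y : E3 => F (t • y) i * (⟪ξ, y⟫ ^ k * ballWeight r (n + 1) y) := by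
    intro t
    have := continuous_comp_apply (hFc.comp (continuous_const_smul t)) i
    simp only [Function.comp] at this
    fun_prop
  refine (hasDerivAt_integral_of_dominated_loc_of_deriv_le
    (bound := (Metric.closedBall (0 : E3) r).indicator fun _ => C)
    (F' := fun t y => fderiv ℝ F (t • y) y i * (⟪ξ, y⟫ ^ k * ballWeight r (n + 1) y))
    (Icc_mem_nhds (by linarith : t - 1 < t) (by linarith : t < t + 1))
    (.of_forall fun t => (hm t).aestronglyMeasurable)
    ((hm t).integrable_of_hasCompactSupport hwc.mul_left.mul_left)
    (hg.comp (by fun_prop : Continuous fun y : E3 => (t, y))).aestronglyMeasurable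
    (.of_forall fun y x hx => ?_) ?_ (.of_forall fun y x hx => ?_)).2
  · rcases lt_or_ge r ‖y‖ with hy | hy
    · rw [ballWeight_eq_zero hr (by omega) hy.le, indicator_of_notMem (by simpa using hy)]
      simp
    · have hy' : y ∈ Metric.closedBall (0 : E3) r := by simpa using hy
      rw [indicator_of_mem hy']
      exact hC (x, y) ⟨hx, hy'⟩
  · exact (integrable_indicator_iff measurableSet_closedBall).2
      (integrableOn_const (isCompact_closedBall (0 : E3) r).measure_lt_top.ne)
  · have h1 : HasDerivAt (fun x : ℝ => x • y) y x := by
      simpa using (hasDerivAt_id x).smul_const y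
    have h2 := (hasFDerivAt_comp
      (hF.contDiff.differentiable (by simp) (x • y)).hasFDerivAt i).comp_hasDerivAt x h1
    exact h2.mul_const _

/-- Applied to the dilate `F(t y)`, whose radial derivative is `t DF(t y) y`, the moment identity
becomes an ordinary differential equation in `t`. -/
theorem mul_deriv_moment_dilate (hr : 0 ≤ r) (hF : CurlDivFree r F) (i : Fin 3) (ξ : E3) (k n : ℕ)
    {t : ℝ} (ht : t ∈ Icc (0 : ℝ) 1) :
    t * ∫ y, fderiv ℝ F (t • y) y i * (⟪ξ, y⟫ ^ k * ballWeight r (n + 2) y) =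
      k * moment r (fun y => F (t • y)) i ξ k (n + 2)
      - k * (k - 1) * ‖ξ‖ ^ 2 / (2 * (n + 3))
        * moment r (fun y => F (t • y)) i ξ (k - 2) (n + 3) := by
  rw [← moment_identity hr (hF.dilate ht), ← integral_const_mul]
  congr 1
  funext y
  have := ((hF.contDiff.differentiable (by simp) (t • y)).hasFDerivAt).comp y
    ((hasFDerivAt_id y).const_smul t)
  have h2 : fderiv ℝ (fun y => F (t • y)) y y = t • fderiv ℝ F (t • y) y := by
    refine (congr_arg (fun l => l y) this.fderiv).trans ?_
    simp
  rw [h2, PiLp.smul_apply, smul_eq_mul]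
  ring

/-- Mean value property. -/
theorem integral_dilate_mul_ballWeight (hr : 0 ≤ r) (hF : CurlDivFree r F) (i : Fin 3) {t : ℝ}
    (ht : t ∈ Icc (0 : ℝ) 1) :
    ∫ y, F (t • y) i * ballWeight r 2 y = F 0 i * ∫ y, ballWeight r 2 y := by
  set M : ℝ → ℝ := fun t => moment r (fun y => F (t • y)) i 0 0 2 with hM
  have hder := hF.hasDerivAt_moment_dilate hr i 0 0 1
  have hcont : Continuous M := continuous_iff_continuousAt.2 fun t => (hder t).continuousAt
  -- For `k = 0` the equation reads `x M'(x) = 0`, which is silent at `x = 0`; that endpoint is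
  -- reached by continuity.
  have hconst : ∀ ε ∈ Ioc (0 : ℝ) t, M t = M ε := by
    intro ε hε
    refine constant_of_has_deriv_right_zero (b := 1) hcont.continuousOn (fun x hx => ?_) t
      ⟨hε.2, ht.2⟩
    have hx0 : 0 < x := hε.1.trans_le hx.1
    have h1 := hF.mul_deriv_moment_dilate hr i 0 0 0 ⟨hx0.le, hx.2.le⟩
    have h2 : ∫ y, fderiv ℝ F (x • y) y i * (⟪(0 : E3), y⟫ ^ 0 * ballWeight r 2 y) = 0 := by
      rcases mul_eq_zero.1 (h1.trans (by simp)) with h | h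
      · exact absurd h hx0.ne'
      · exact h
    have := hder x
    rw [h2] at this
    exact this.hasDerivWithinAt
  have hM0 : M t = M 0 := by
    rcases ht.1.eq_or_lt with h | h
    · rw [← h]
    · have h1 : Tendsto M (𝓝[>] 0) (𝓝 (M 0)) := hcont.continuousWithinAt
      refine tendsto_nhds_unique (tendsto_const_nhds.congr' ?_) h1
      filter_upwards [Ioc_mem_nhdsGT h] with ε hε using hconst ε hε
  simpa [hM, moment, integral_const_mul] using hM0

/-- Strong maximum principle from the mean value property: a continuous function of one sign with
zero weighted mean vanishes. The dilation shrinks the ball into the region where the sign is known.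
-/
theorem eventually_eq_zero_of_eventually_mul_nonneg (hr : 0 < r) (hF : CurlDivFree r F) (hF0 : F 0 = 0)
    {i : Fin 3} {σ : ℝ} (hσ : σ ≠ 0) (h : ∀ᶠ y in 𝓝 (0 : E3), 0 ≤ σ * F y i) :
    ∀ᶠ y in 𝓝 (0 : E3), F y i = 0 := by
  obtain ⟨ε, hε, hball⟩ := Metric.eventually_nhds_iff.1 h
  set t : ℝ := min 1 (ε / (2 * r)) with ht
  have htpos : 0 < t := lt_min one_pos (by positivity)
  have htr : t * r < ε := by
    calc t * r ≤ ε / (2 * r) * r := by gcongr; exact min_le_right _ _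
      _ = ε / 2 := by field_simp
      _ < ε := by linarith
  have hmean := hF.integral_dilate_mul_ballWeight hr.le i ⟨htpos.le, min_le_left _ _⟩
  rw [hF0, PiLp.zero_apply, zero_mul] at hmean
  have hcont : Continuous fun y : E3 => σ * (F (t • y) i * ballWeight r 2 y) := by
    have h1 := continuous_comp_apply (hF.contDiff.continuous.comp (continuous_const_smul t)) i
    have h2 := continuous_ballWeight (r := r) (n := 2)
    exact continuous_const.mul (h1.mul h2)
  have hnn : ∀ y : E3, 0 ≤ σ * (F (t • y) i * ballWeight r 2 y) := by
    intro y
    rcases lt_or_ge ‖y‖ r with hy | hy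
    · have : dist (t • y) 0 < ε := by
        rw [dist_zero_right, norm_smul, Real.norm_of_nonneg htpos.le]
        exact lt_of_le_of_lt (by gcongr) htr
      rw [← mul_assoc]
      exact mul_nonneg (hball this) (ballWeight_nonneg y)
    · rw [ballWeight_eq_zero hr.le (by omega) hy]; simp
  have hint : Integrable fun y : E3 => σ * (F (t • y) i * ballWeight r 2 y) :=
    hcont.integrable_of_hasCompactSupport
      (hasCompactSupport_ballWeight hr.le (by omega)).mul_left.mul_left
  have h0 := (integral_eq_zero_iff_of_nonneg hnn hint).1
    (by rw [integral_const_mul, hmean, mul_zero])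
  have h0' := (hcont.ae_eq_iff_eq volume continuous_zero).1 h0
  filter_upwards [Metric.ball_mem_nhds (0 : E3) (mul_pos htpos hr)] with y hy
  rw [mem_ball_zero_iff] at hy
  have h1 := congr_fun h0' (t⁻¹ • y)
  have h2 : ‖t⁻¹ • y‖ < r := by
    rw [norm_smul, Real.norm_of_nonneg (by positivity), inv_mul_lt_iff₀ htpos]
    exact hy
  simpa [hσ, smul_smul, htpos.ne', (ballWeight_pos h2).ne'] using h1

theorem eventually_eq_zero_of_isLocalExtr (hr : 0 < r) (hF : CurlDivFree r F) (hF0 : F 0 = 0)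
    {i : Fin 3} (h : IsLocalExtr (fun y => F y i) 0) : ∀ᶠ y in 𝓝 (0 : E3), F y i = 0 := by
  rcases h with h | h
  · refine hF.eventually_eq_zero_of_eventually_mul_nonneg hr hF0 one_ne_zero ?_
    filter_upwards [h] with y hy
    simpa [hF0] using hy
  · refine hF.eventually_eq_zero_of_eventually_mul_nonneg hr hF0 (neg_ne_zero.2 one_ne_zero) ?_
    filter_upwards [h] with y hy
    simpa [hF0] using hy

/-- Strong induction on `k`: once the moments of degree `k - 2` vanish, for every weight exponent,
`x M' = k M`, so `M / x^k` is constant. It is zero for small `x`, where the dilate sees only the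
region `F = 0`. -/
theorem moment_eq_zero (hr : 0 ≤ r) (hF : CurlDivFree r F) {ε : ℝ} (hε : 0 < ε)
    (h0 : ∀ y, ‖y‖ < ε → F y = 0) (i : Fin 3) (ξ : E3) (k n : ℕ) {t : ℝ} (ht : t ∈ Icc (0 : ℝ) 1) :
    moment r (fun y => F (t • y)) i ξ k (n + 2) = 0 := by
  have hsmall : ∀ k n t, 0 ≤ t → t * r < ε → moment r (fun y => F (t • y)) i ξ k (n + 2) = 0 := by
    intro k n t ht htr
    rw [moment, ← integral_zero E3 ℝ (μ := volume)]
    congr 1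
    funext y
    rcases lt_or_ge ‖y‖ r with hy | hy
    · rw [h0 (t • y), PiLp.zero_apply, zero_mul]
      rw [norm_smul, Real.norm_of_nonneg ht]
      exact lt_of_le_of_lt (by gcongr) htr
    · rw [ballWeight_eq_zero hr (by omega) hy]; simp
  induction k using Nat.strong_induction_on generalizing n t with
  | _ k ih =>
    set M : ℝ → ℝ := fun t => moment r (fun y => F (t • y)) i ξ k (n + 2) with hM
    have hder := hF.hasDerivAt_moment_dilate hr i ξ k (n + 1)
    have hcont : Continuous M := continuous_iff_continuousAt.2 fun t => (hder t).continuousAt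
    obtain ⟨t₀, ht₀, ht₀r⟩ : ∃ t₀ : ℝ, 0 < t₀ ∧ t₀ * r < ε := by
      refine ⟨ε / (r + 1), by positivity, ?_⟩
      rw [div_mul_eq_mul_div, div_lt_iff₀ (by positivity)]
      nlinarith
    rcases le_total t t₀ with htt | htt
    · exact hsmall k n t ht.1 (lt_of_le_of_lt (by gcongr) ht₀r)
    have hpos : ∀ x ∈ Icc t₀ (1 : ℝ), 0 < x := fun x hx => ht₀.trans_le hx.1
    have hg : ∀ x ∈ Icc t₀ (1 : ℝ), M x / x ^ k = M t₀ / t₀ ^ k := by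
      refine constant_of_has_deriv_right_zero
        (hcont.continuousOn.div (by fun_prop) fun x hx => (pow_pos (hpos x hx) k).ne')
        fun x hx => ?_
      have hx0 := hpos x ⟨hx.1, hx.2.le⟩
      have hx1 : x ∈ Icc (0 : ℝ) 1 := ⟨hx0.le, hx.2.le⟩
      have h1 := hF.mul_deriv_moment_dilate hr i ξ k n hx1
      have h2 : (k : ℝ) * (k - 1) * ‖ξ‖ ^ 2 / (2 * (n + 3)) *
          moment r (fun y => F (x • y)) i ξ (k - 2) (n + 3) = 0 := by
        rcases k with _ | _ | k
        · simp
        · simp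
        · rw [ih (k + 1 + 1 - 2) (by omega) (n + 1) hx1, mul_zero]
      rw [h2, sub_zero] at h1
      have h3 := (hder x).div (hasDerivAt_pow k x) (pow_pos hx0 k).ne'
      refine (h3.congr_deriv ?_).hasDerivWithinAt
      rw [div_eq_zero_iff]
      left
      change (∫ y, fderiv ℝ F (x • y) y i * (⟪ξ, y⟫ ^ k * ballWeight r (n + 2) y)) * x ^ k
        - moment r (fun y => F (x • y)) i ξ k (n + 2) * (k * x ^ (k - 1)) = 0
      rcases k with _ | k
      · simp only [CharP.cast_eq_zero, zero_mul, mul_eq_zero, hx0.ne', false_or] at h1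
        rw [h1]; simp
      · rw [Nat.add_sub_cancel, pow_succ]
        linear_combination x ^ k * h1
    have h1 := hg t ⟨htt, ht.2⟩
    rw [hM] at h1
    simp only at h1
    rw [hsmall k n t₀ ht₀.le ht₀r, zero_div, div_eq_zero_iff] at h1
    exact h1.resolve_right (pow_pos (ht₀.trans_le htt) k).ne'

end CurlDivFree

/-! ### Determination by moments and unique continuation -/

/-- A continuous function supported in a ball whose moments against all powers of linear forms
vanish is zero. -/
theorem eq_zero_of_moments_eq_zero {g : E3 → ℝ} (hg : Continuous g) {r : ℝ}
    (hgr : ∀ y, r ≤ ‖y‖ → g y = 0) (h : ∀ (ξ : E3) (k : ℕ), ∫ y, g y * ⟪ξ, y⟫ ^ k = 0) (y : E3) :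
    g y = 0 := by
  set G : E3 → ℂ := fun y => (g y : ℂ) with hG
  have hGc : Continuous G := Complex.continuous_ofReal.comp hg
  have hsupp : HasCompactSupport g :=
    HasCompactSupport.intro (isCompact_closedBall (0 : E3) r) fun y hy => by
      rw [Metric.mem_closedBall, dist_zero_right, not_le] at hy
      exact hgr y hy.le
  have hGs : HasCompactSupport G := hsupp.comp_left (g := fun x : ℝ => (x : ℂ)) (by simp)
  have hint : Integrable G := hGc.integrable_of_hasCompactSupport hGs
  -- Compact support lets the exponential be expanded and integrated term by term; the terms are
  -- multiples of the moments. Fourier inversion then gives `G = 0`.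
  have hF : 𝓕 G = 0 := by
    funext ξ
    rw [Real.fourier_eq']
    set f : ℕ → E3 → ℂ := fun k y =>
      ((k.factorial : ℂ)⁻¹ * (-2 * Real.pi * Complex.I) ^ k) * ((g y * ⟪ξ, y⟫ ^ k : ℝ) : ℂ) with hf
    have hfc : ∀ k, Integrable (f k) := by
      intro k
      refine Integrable.const_mul (Integrable.ofReal ?_) _
      exact (hg.mul (by fun_prop)).integrable_of_hasCompactSupport hsupp.mul_right
    have hbound : ∀ k y, ‖f k y‖ ≤ ((k.factorial : ℝ)⁻¹ * (2 * Real.pi * (‖ξ‖ * r)) ^ k) * ‖g y‖ := by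
      intro k y
      rcases le_or_gt r ‖y‖ with hy | hy
      · simp [hf, hgr y hy]
      · have h1 : |⟪ξ, y⟫| ≤ ‖ξ‖ * r :=
          (abs_real_inner_le_norm ξ y).trans (by gcongr)
        simp only [hf, norm_mul, norm_pow, norm_inv, Complex.norm_natCast, norm_neg,
          Complex.norm_ofNat, Complex.norm_real, Complex.norm_I, mul_one, Real.norm_eq_abs,
          abs_of_pos Real.pi_pos]
        calc ((k.factorial : ℝ)⁻¹ * (2 * Real.pi) ^ k) * (|g y| * |⟪ξ, y⟫| ^ k)
            ≤ ((k.factorial : ℝ)⁻¹ * (2 * Real.pi) ^ k) * (|g y| * (‖ξ‖ * r) ^ k) := by gcongr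
          _ = _ := by rw [mul_pow (2 * Real.pi)]; ring
    have hsum : Summable fun k => ∫ y, ‖f k y‖ := by
      have hs : Summable fun k : ℕ =>
          ((k.factorial : ℝ)⁻¹ * (2 * Real.pi * (‖ξ‖ * r)) ^ k) * ∫ y, ‖g y‖ := by
        refine Summable.mul_right _ ?_
        refine (Real.summable_pow_div_factorial (2 * Real.pi * (‖ξ‖ * r))).congr fun k => ?_
        rw [div_eq_inv_mul]
      refine hs.of_nonneg_of_le (fun k => integral_nonneg fun y => norm_nonneg _) fun k => ?_
      rw [← integral_const_mul]
      exact integral_mono (hfc k).norm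
        ((hg.integrable_of_hasCompactSupport hsupp).norm.const_mul _) (hbound k)
    have hHS := hasSum_integral_of_summable_integral_norm hfc hsum
    have hzero : ∀ k, ∫ y, f k y = 0 := by
      intro k
      simp only [hf]
      rw [integral_const_mul, integral_complex_ofReal, h ξ k]
      simp
    simp only [hzero] at hHS
    have hexp : ∀ y, ∑' k, f k y = Complex.exp (((-2 * Real.pi * ⟪y, ξ⟫ : ℝ) : ℂ) * Complex.I) • G y := by
      intro y
      rw [Complex.exp_eq_exp_ℂ, NormedSpace.exp_eq_tsum_div, smul_eq_mul, ← tsum_mul_right]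
      congr 1
      funext k
      simp only [hf, hG, real_inner_comm ξ y]
      push_cast
      rw [mul_pow, mul_pow, mul_pow, mul_pow]
      ring
    simp only [hexp] at hHS
    exact hHS.unique hasSum_zero
  have hinv := hGc.fourierInv_fourier_eq hint (by rw [hF]; exact integrable_zero _ _ _)
  have h2 := congr_fun hinv y
  rw [hF] at h2
  have h3 : (𝓕⁻ (0 : E3 → ℂ)) y = 0 := by simp [Real.fourierInv_eq]
  rw [h3] at h2
  simpa [hG] using h2.symm

/-- Unique continuation for curl and divergence free fields. -/
theorem CurlDivFree.eq_zero {r : ℝ} {F : E3 → E3} (hF : CurlDivFree r F) {ε : ℝ} (hε : 0 < ε)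
    (h0 : ∀ y, ‖y‖ < ε → F y = 0) {y : E3} (hy : ‖y‖ < r) : F y = 0 := by
  have hr : 0 ≤ r := (norm_nonneg y).trans hy.le
  ext i
  have hg : Continuous fun y => F y i * ballWeight r 2 y :=
    (continuous_comp_apply hF.contDiff.continuous i).mul continuous_ballWeight
  have h1 := eq_zero_of_moments_eq_zero hg (r := r)
    (fun y hy => by rw [ballWeight_eq_zero hr (by omega) hy, mul_zero])
    (fun ξ k => by
      have := hF.moment_eq_zero hr hε h0 i ξ k 0 (t := 1) (by simp)
      simp only [CurlDivFree.moment, one_smul] at this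
      rw [← this]
      congr 1
      funext y
      ring) y
  simpa [(ballWeight_pos hy).ne'] using h1

/-! ### Uniformity in time from periodicity -/

section Periodic

theorem Function.Periodic.eq_of_eq_on_Ioo {α : Type*} [TopologicalSpace α] [T2Space α] {f : ℝ → α}
    {S c : ℝ} {z : α} (hS : 0 < S) (hper : Function.Periodic f S) (hf : Continuous f)
    (h : ∀ s ∈ Ioo c (c + S), f s = z) (s : ℝ) : f s = z := by
  obtain ⟨t, ht, hst⟩ := hper.exists_mem_Ico hS s c
  rw [hst]
  have hcl : EqOn f (fun _ => z) (closure (Ioo c (c + S))) :=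
    EqOn.closure (fun s hs => h s hs) hf continuous_const
  rw [closure_Ioo (by linarith)] at hcl
  exact hcl (Ico_subset_Icc_self ht)

/-- The tube lemma over one compact period. `R = 0` gives smallness near the origin; `R > 0` gives
the enlargement step of the continuation. -/
theorem exists_lt_on_larger_ball {g : E3 × ℝ → ℝ} (hg : Continuous g) {S R ε : ℝ} (hS : 0 < S)
    (hper : ∀ y, Function.Periodic (fun s => g (y, s)) S) (hR : 0 ≤ R)
    (h : ∀ y s, ‖y‖ ≤ R → g (y, s) < ε) :
    ∃ ρ > 0, ∀ y s, ‖y‖ ≤ R + ρ → g (y, s) < ε := by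
  obtain ⟨u, v, hu, -, hKu, hIv, huv⟩ := generalized_tube_lemma
    (isCompact_closedBall (0 : E3) R) (isCompact_Icc (a := (0 : ℝ)) (b := S))
    (isOpen_Iio.preimage hg : IsOpen (g ⁻¹' Iio ε))
    (fun p hp => h p.1 p.2 (by simpa using hp.1))
  obtain ⟨δ, hδ, hδu⟩ := (isCompact_closedBall (0 : E3) R).exists_cthickening_subset_open hu hKu
  rw [cthickening_closedBall hδ.le hR] at hδu
  refine ⟨δ, hδ, fun y s hy => ?_⟩
  obtain ⟨t, ht, hst⟩ := (hper y).exists_mem_Ico₀ hS s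
  rw [hst]
  exact huv (mk_mem_prod (hδu (by simpa [add_comm] using hy)) (hIv (Ico_subset_Icc_self ht)))

theorem exists_bound_on_ball {g : E3 × ℝ → ℝ} (hg : Continuous g) {S : ℝ} (hS : 0 < S)
    (hper : ∀ y, Function.Periodic (fun s => g (y, s)) S) (r : ℝ) :
    ∃ M, ∀ y s, ‖y‖ ≤ r → g (y, s) ≤ M := by
  obtain ⟨M, hM⟩ := ((isCompact_closedBall (0 : E3) r).prod
    (isCompact_Icc (a := (0 : ℝ)) (b := S))).bddAbove_image hg.continuousOn
  refine ⟨M, fun y s hy => ?_⟩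
  obtain ⟨t, ht, hst⟩ := (hper y).exists_mem_Ico₀ hS s
  rw [hst]
  exact hM ⟨(y, t), ⟨by simpa using hy, Ico_subset_Icc_self ht⟩, rfl⟩

end Periodic

/-! ### Vanishing of the vorticity and continuation of the zero set -/

section Core

variable {a b S : ℝ} {V : E3 → ℝ → E3} {P : E3 → ℝ → ℝ}

/-- The spatial derivative of a space-time field. -/
noncomputable def spaceDeriv (V : E3 → ℝ → E3) (p : E3 × ℝ) : E3 →L[ℝ] E3 :=
  fderiv ℝ (fun z => V z p.2) p.1

theorem spaceDeriv_eq (hv : ContDiff ℝ 1 (uncurry V)) (p : E3 × ℝ) :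
    spaceDeriv V p = (fderiv ℝ (uncurry V) p).comp (ContinuousLinearMap.inl ℝ E3 ℝ) :=
  (hasFDerivAt_slice_space hv p.1 p.2).fderiv

theorem continuous_spaceDeriv (hv : ContDiff ℝ 1 (uncurry V)) : Continuous (spaceDeriv V) := by
  rw [funext (spaceDeriv_eq hv)]
  exact (hv.continuous_fderiv (by simp)).clm_comp continuous_const

theorem spaceDeriv_periodic (hper : ∀ y, Function.Periodic (V y) S) (y : E3) :
    Function.Periodic (fun s => spaceDeriv V (y, s)) S := fun s => by
  simp only [spaceDeriv, fun z => hper z s]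

theorem vorticity_periodic (hper : ∀ y, Function.Periodic (V y) S) (y : E3) (s : ℝ) :
    vorticity V (y, s + S) = vorticity V (y, s) := by
  simp only [vorticity, fun z => hper z s]

theorem contDiff_slice (hv : ContDiff ℝ 1 (uncurry V)) (s : ℝ) : ContDiff ℝ 1 fun y => V y s :=
  hv.comp (contDiff_id.prodMk contDiff_const)

/-- The transport theorem with outward rate `b - θ` and growth rate `M - (a + b)`, both read off
from the vorticity equation. It serves near the origin and in the continuation. -/
theorem vorticity_eq_zero_of_bounds (hS : 0 < S) (hv : ContDiff ℝ 1 (uncurry V))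
    (hw : ContDiff ℝ 1 (vorticity V)) (hsol : IsSelfSimilarEulerSolution a b V P)
    (hper : ∀ y, Function.Periodic (V y) S) {r θ M : ℝ} {m : ℕ} (hb : 0 ≤ b) (hθ : θ < b)
    (hV : ∀ y s, ‖y‖ ≤ r → ‖V y s‖ ≤ θ * ‖y‖)
    (hD : ∀ y s, ‖y‖ ≤ r → ‖spaceDeriv V (y, s)‖ ≤ M) (hm : M - (a + b) < m * (b - θ)) {s₁ : ℝ}
    (h₁ : ∀ η > 0, ∃ ρ > 0, ∀ y, ‖y‖ ≤ ρ → ‖vorticity V (y, s₁)‖ ≤ η * ‖y‖ ^ m)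
    {y : E3} (hy : ‖y‖ ≤ r) (s : ℝ) : vorticity V (y, s) = 0 := by
  refine eq_zero_of_periodic_transport (w := vorticity V) (m := m) (L := b + θ) (c := b - θ)
    (κ := M - (a + b)) (u := fun p => b • p.1 + uncurry V p) (hw.differentiable (by simp)) hS
    (vorticity_periodic hper) (by linarith) ?_ ?_ ?_ hm (s₁ := s₁) ?_ hy s
  · rintro ⟨y, s⟩ hy
    have h1 := neg_le_of_abs_le (abs_real_inner_le_norm y (V y s))
    have h2 := mul_le_mul_of_nonneg_left (hV y s hy) (norm_nonneg y)
    simp only [inner_add_right, inner_smul_right, real_inner_self_eq_norm_sq, uncurry]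
    nlinarith
  · rintro ⟨y, s⟩ hy
    refine (norm_add_le _ _).trans ?_
    rw [norm_smul, Real.norm_of_nonneg hb, add_mul]
    gcongr
    exact hV y s hy
  · rintro ⟨y, s⟩ hy
    have hD' : fderiv ℝ (uncurry V) (y, s) (vorticity V (y, s), 0) =
        spaceDeriv V (y, s) (vorticity V (y, s)) := by rw [spaceDeriv_eq hv]; rfl
    rw [vorticity_equation hv hw hsol, inner_add_right, inner_smul_right,
      real_inner_self_eq_norm_sq, hD']
    have h1 := real_inner_le_norm (vorticity V (y, s)) (spaceDeriv V (y, s) (vorticity V (y, s)))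
    have h2 := (spaceDeriv V (y, s)).le_of_opNorm_le (hD y s hy) (vorticity V (y, s))
    have h3 := mul_le_mul_of_nonneg_left h2 (norm_nonneg (vorticity V (y, s)))
    nlinarith
  · intro η hη
    obtain ⟨ρ, hρ, h⟩ := h₁ (√η) (Real.sqrt_pos.2 hη)
    refine ⟨ρ, hρ, fun y hy => ?_⟩
    have h2 := pow_le_pow_left₀ (norm_nonneg _) (h y hy) 2
    rwa [mul_pow, Real.sq_sqrt hη.le, pow_right_comm] at h2

theorem curlDivFree_slice (hv : ContDiff ℝ 1 (uncurry V))
    (hsol : IsSelfSimilarEulerSolution a b V P) {r : ℝ}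
    (h : ∀ y s, ‖y‖ ≤ r → vorticity V (y, s) = 0) (s : ℝ) : CurlDivFree r fun y => V y s :=
  .of_curl_eq_zero (contDiff_slice hv s) (fun y hy => h y s hy.le)
    fun y _ => hsol.incompressible y s

theorem vorticity_eq_zero_of_eq_zero {R : ℝ} (h : ∀ y s, ‖y‖ < R → V y s = 0) {y : E3}
    (hy : ‖y‖ < R) (s : ℝ) : vorticity V (y, s) = 0 := by
  have hev : (fun z => V z s) =ᶠ[𝓝 y] fun _ => 0 := by
    filter_upwards [Metric.isOpen_ball.mem_nhds (show y ∈ Metric.ball (0 : E3) R by simpa using hy)]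
      with z hz using h z s (by simpa using hz)
  have h0 : fderiv ℝ (fun z => V z s) y = 0 := by rw [hev.fderiv_eq]; simp
  ext i
  simp [vorticity, curl_apply, partialComp, h0]

/-- A periodic solution that vanishes near the origin vanishes identically. -/
theorem eq_zero_of_eq_zero_near (hS : 0 < S) (hv : ContDiff ℝ 1 (uncurry V))
    (hw : ContDiff ℝ 1 (vorticity V)) (hsol : IsSelfSimilarEulerSolution a b V P)
    (hper : ∀ y, Function.Periodic (V y) S) (hb : 0 < b) {r₀ : ℝ} (hr₀ : 0 < r₀)
    (h0 : ∀ y s, ‖y‖ < r₀ → V y s = 0) (y : E3) (s : ℝ) : V y s = 0 := by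
  by_contra hne
  set T : Set ℝ := {R | ∀ y s, ‖y‖ < R → V y s = 0} with hT
  have hbdd : BddAbove T := ⟨‖y‖, fun R hR => by
    by_contra! hlt
    exact hne (hR y s hlt)⟩
  set R := sSup T with hRdef
  have hRr : r₀ ≤ R := le_csSup hbdd h0
  have hR : 0 < R := hr₀.trans_le hRr
  have hopen : ∀ y s, ‖y‖ < R → V y s = 0 := by
    intro y s hy
    obtain ⟨R', hR', hlt⟩ := exists_lt_of_lt_csSup (⟨r₀, h0⟩ : T.Nonempty) hy
    exact hR' y s hlt
  have hclosed : ∀ y s, ‖y‖ ≤ R → V y s = 0 := by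
    intro y s hy
    have hcl : EqOn (fun z => V z s) (fun _ => 0) (closure (Metric.ball (0 : E3) R)) :=
      EqOn.closure (fun z hz => hopen z s (by simpa using hz)) (contDiff_slice hv s).continuous
        continuous_const
    rw [closure_ball _ hR.ne'] at hcl
    exact hcl (by simpa using hy)
  -- Beyond radius `R` this gives `‖V‖ ≤ (b/2) R ≤ (b/2) ‖y‖`, and `V = 0` inside, so the field
  -- stays outward with rate `b/2`.
  obtain ⟨ρ, hρ, hsmall⟩ := exists_lt_on_larger_ball (g := fun p => ‖uncurry V p‖) (ε := b / 2 * R)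
    hv.continuous.norm hS (fun y s => by simp only [uncurry, hper y s]) hR.le
    (fun y s hy => by simp only [uncurry, hclosed y s hy, norm_zero]; positivity)
  obtain ⟨M, hM⟩ := exists_bound_on_ball (continuous_spaceDeriv hv).norm hS
    (fun y s => congr_arg norm (spaceDeriv_periodic hper y s)) (R + ρ)
  -- `DV` need not be small here; since `ω = 0` near the origin, `m` may be as large as `M` demands.
  obtain ⟨m, hm⟩ := exists_nat_gt ((M - (a + b)) / (b - b / 2))
  have hω : ∀ y s, ‖y‖ ≤ R + ρ → vorticity V (y, s) = 0 := by
    intro y s hy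
    refine vorticity_eq_zero_of_bounds hS hv hw hsol hper (θ := b / 2) (m := m) hb.le (by linarith)
      (fun y s hy => ?_) hM ((div_lt_iff₀ (by linarith)).1 hm) (s₁ := 0) (fun η hη => ?_) hy s
    · rcases le_total ‖y‖ R with hyR | hyR
      · rw [hclosed y s hyR, norm_zero]; positivity
      · exact (hsmall y s hy).le.trans (by gcongr)
    · refine ⟨R / 2, by positivity, fun y hy => ?_⟩
      rw [vorticity_eq_zero_of_eq_zero hopen (by linarith), norm_zero]
      positivity
  have hmem : R + ρ ∈ T := fun y s hy =>
    (curlDivFree_slice hv hsol hω s).eq_zero hR (fun z hz => hopen z s hz) hy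
  linarith [le_csSup hbdd hmem]

theorem eq_zero_of_localExtr_of_vorticity_isLittleO (hS : 0 < S) (hv : ContDiff ℝ 1 (uncurry V))
    (hw : ContDiff ℝ 1 (vorticity V)) (hsol : IsSelfSimilarEulerSolution a b V P)
    (hper : ∀ y, Function.Periodic (V y) S) (hb : 0 < b) {c : ℝ}
    (hextr : ∀ s ∈ Ioo c (c + S), ∀ i : Fin 3, IsLocalExtr (fun y => V y s i) 0)
    (hzero : ∀ s ∈ Ioo c (c + S), V 0 s = 0) {m : ℕ} (hm : 0 < m * b + (a + b)) {s₁ : ℝ}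
    (h₁ : ∀ η > 0, ∃ ρ > 0, ∀ y, ‖y‖ ≤ ρ → ‖vorticity V (y, s₁)‖ ≤ η * ‖y‖ ^ m)
    (y : E3) (s : ℝ) : V y s = 0 := by
  have hV0 : ∀ s, V 0 s = 0 := (hper 0).eq_of_eq_on_Ioo hS
    (hv.continuous.comp (by fun_prop : Continuous fun s : ℝ => ((0 : E3), s))) hzero
  have hD0 : ∀ s, spaceDeriv V (0, s) = 0 := by
    refine (spaceDeriv_periodic hper 0).eq_of_eq_on_Ioo (c := c) hS
      ((continuous_spaceDeriv hv).comp (by fun_prop : Continuous fun s : ℝ => ((0 : E3), s)))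
      fun s hs => ?_
    ext v i
    have h1 := (hextr s hs i).fderiv_eq_zero
    have h2 := fderiv_comp_apply ((contDiff_slice hv s).differentiable (by simp) 0) i v
    rw [h1] at h2
    simpa [spaceDeriv] using h2.symm
  set X := m * b + (a + b) with hX
  -- With `ε` bounding both `‖DV‖` and `‖V‖ / ‖y‖`, the condition `ε - (a + b) < m (b - ε)` is `(m +
  -- 1) ε < X`.
  set ε := min (b / 2) (X / (2 * (m + 1))) with hε
  have hεpos : 0 < ε := lt_min (by positivity) (by positivity)
  have hεb : ε < b := (min_le_left _ _).trans_lt (by linarith)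
  have hεX : (m + 1) * ε < X := by
    calc (m + 1) * ε ≤ (m + 1) * (X / (2 * (m + 1))) := by gcongr; exact min_le_right _ _
      _ = X / 2 := by field_simp
      _ < X := by linarith
  obtain ⟨r, hr, hDr⟩ := exists_lt_on_larger_ball (ε := ε) (continuous_spaceDeriv hv).norm hS
    (fun y s => congr_arg norm (spaceDeriv_periodic hper y s)) le_rfl
    (fun y s hy => by rw [norm_le_zero_iff.1 hy, hD0, norm_zero]; exact hεpos)
  rw [zero_add] at hDr
  have hVr : ∀ y s, ‖y‖ ≤ r → ‖V y s‖ ≤ ε * ‖y‖ := by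
    intro y s hy
    have := (convex_closedBall (0 : E3) r).norm_image_sub_le_of_norm_fderiv_le (𝕜 := ℝ)
      (f := fun z => V z s) (C := ε)
      (fun z _ => (contDiff_slice hv s).differentiable (by simp) z)
      (fun z hz => (hDr z s (by simpa using hz)).le) (Metric.mem_closedBall_self hr.le)
      (show y ∈ Metric.closedBall (0 : E3) r by simpa using hy)
    simpa [hV0] using this
  have hω : ∀ y s, ‖y‖ ≤ r → vorticity V (y, s) = 0 := fun y s hy =>
    vorticity_eq_zero_of_bounds hS hv hw hsol hper hb.le hεb hVr (fun y s hy => (hDr y s hy).le)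
      (by linarith) h₁ hy s
  refine eq_zero_of_eq_zero_near hS hv hw hsol hper hb hr (fun y s hy => ?_) y s
  refine (hper y).eq_of_eq_on_Ioo (c := c) hS
    (hv.continuous.comp (by fun_prop : Continuous fun s : ℝ => (y, s))) (fun s hs => ?_) s
  have hF := curlDivFree_slice hv hsol hω s
  have hev : ∀ᶠ z in 𝓝 (0 : E3), ∀ i, V z s i = 0 :=
    eventually_all.2 fun i => hF.eventually_eq_zero_of_isLocalExtr hr (hV0 s) (hextr s hs i)
  obtain ⟨δ, hδ, hball⟩ := Metric.eventually_nhds_iff.1 hev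
  refine hF.eq_zero hδ (fun z hz => ?_) hy
  ext i
  exact hball (by simpa using hz) i

end Core

/-! ### Order of vanishing from vanishing derivatives -/

section Taylor

theorem isLittleO_pow_of_iteratedFDeriv_eq_zero {E : Type} [NormedAddCommGroup E] [NormedSpace ℝ E]
    (n : ℕ) : ∀ {F : Type} [NormedAddCommGroup F] [NormedSpace ℝ F] {f : E → F},
    ContDiffAt ℝ n f 0 → (∀ k ≤ n, iteratedFDeriv ℝ k f 0 = 0) →
      f =o[𝓝 0] fun x => ‖x‖ ^ n := by
  induction n with
  | zero =>
    intro F _ _ f hf h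
    have h0 : f 0 = 0 := by
      have := h 0 le_rfl
      rw [← norm_eq_zero, norm_iteratedFDeriv_zero, norm_eq_zero] at this
      exact this
    simp only [pow_zero]
    rw [isLittleO_one_iff]
    simpa [h0] using hf.continuousAt.tendsto
  | succ n ih =>
    intro F _ _ f hf h
    have hf' : ContDiffAt ℝ n (fderiv ℝ f) 0 := hf.fderiv_right (by norm_cast)
    have hd := ih hf' fun k hk => by
      rw [← norm_eq_zero, norm_iteratedFDeriv_fderiv, h (k + 1) (by omega), norm_zero]
    have h0 : f 0 = 0 := by
      have := h 0 (by omega)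
      rw [← norm_eq_zero, norm_iteratedFDeriv_zero, norm_eq_zero] at this
      exact this
    have hdiff : ∀ᶠ x in 𝓝 (0 : E), DifferentiableAt ℝ f x := by
      have := hf.eventually (by simp)
      filter_upwards [this] with x hx
      exact hx.differentiableAt (by simp)
    refine isLittleO_iff.2 fun η hη => ?_
    obtain ⟨δ, hδ, hball⟩ := Metric.eventually_nhds_iff.1 (hdiff.and (isLittleO_iff.1 hd hη))
    refine Metric.eventually_nhds_iff.2 ⟨δ, hδ, fun x hx => ?_⟩
    rw [dist_zero_right] at hx
    have hz : ∀ z ∈ Metric.closedBall (0 : E) ‖x‖, dist z 0 < δ := fun z hz =>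
      (Metric.mem_closedBall.1 hz).trans_lt hx
    have := (convex_closedBall (0 : E) ‖x‖).norm_image_sub_le_of_norm_fderiv_le (𝕜 := ℝ)
      (f := f) (C := η * ‖x‖ ^ n) (fun z h => (hball (hz z h)).1)
      (fun z h => ((hball (hz z h)).2).trans (by
        rw [norm_pow, norm_norm]
        gcongr
        simpa using h))
      (Metric.mem_closedBall_self (norm_nonneg x)) (show x ∈ Metric.closedBall (0 : E) ‖x‖ by simp)
    simpa [h0, pow_succ, mul_assoc] using this

end Taylor

/-! ### Joint regularity, time reversal and conclusion -/

section Final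

variable {a b S : ℝ} {V : E3 → ℝ → E3} {P : E3 → ℝ → ℝ}

/-- Partial derivatives that are jointly continuous make the field jointly `C¹`. -/
theorem IsC1TimeHolderSpace.contDiff_uncurry {γ : ℝ}
    (hV : IsC1TimeHolderSpace 1 γ univ univ V) : ContDiff ℝ 1 (uncurry V) := by
  set f₁ : E3 → ℝ → E3 →L[ℝ] E3 := fun y s => fderiv ℝ (fun z => V z s) y
  set f₂ : E3 → ℝ → ℝ →L[ℝ] E3 := fun y s => ContinuousLinearMap.toSpanSingleton ℝ (deriv (V y) s)
  have h₁ : Continuous (uncurry f₁) := by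
    refine continuous_clm_apply.2 fun v => ?_
    have hc := hV.continuousOn_space 1 le_rfl
    rw [univ_prod_univ, continuousOn_univ] at hc
    have := (ContinuousMultilinearMap.apply ℝ (fun _ : Fin 1 => E3) E3 fun _ => v).continuous.comp hc
    refine this.congr fun p => ?_
    simp [f₁, uncurry, iteratedFDeriv_one_apply]
  have h₂ : Continuous (uncurry f₂) := by
    have hc := hV.continuousOn_deriv_time
    rw [univ_prod_univ, continuousOn_univ] at hc
    exact (ContinuousLinearMap.toSpanSingletonCLE (𝕜 := ℝ) (E := E3)).continuous.comp hc
  refine contDiff_one_iff_hasFDerivAt.2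
    ⟨fun p => (uncurry f₁ p).coprod (uncurry f₂ p), ?_, fun p => ?_⟩
  · refine continuous_clm_apply.2 fun v => ?_
    exact (h₁.clm_apply continuous_const).add (h₂.clm_apply continuous_const)
  · refine (hasStrictFDerivAt_uncurry_coprod (f := V) (f₁ := f₁) (f₂ := f₂) (.of_forall fun q => ?_)
      (.of_forall fun q => ?_) h₁.continuousAt h₂.continuousAt).hasFDerivAt
    · have := hV.contDiffOn_space q.2 (mem_univ _)
      rw [contDiffOn_univ] at this
      exact (this.differentiable (by simp) q.1).hasFDerivAt
    · exact (hV.differentiableAt_time q.1 (mem_univ _) q.2 (mem_univ _)).hasDerivAt.hasFDerivAt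

theorem spaceDeriv_reverse (V : E3 → ℝ → E3) (p : E3 × ℝ) :
    spaceDeriv (fun y s => -V y (-s)) p = -spaceDeriv V (p.1, -p.2) := by
  simp only [spaceDeriv]
  exact fderiv_fun_neg

theorem vorticity_reverse (V : E3 → ℝ → E3) (p : E3 × ℝ) :
    vorticity (fun y s => -V y (-s)) p = -vorticity V (p.1, -p.2) := by
  have h := spaceDeriv_reverse V p
  simp only [spaceDeriv] at h
  ext i
  simp only [vorticity, curl_apply, partialComp, h, PiLp.neg_apply, neg_apply]
  ring

theorem IsSelfSimilarEulerSolution.reverse (h : IsSelfSimilarEulerSolution a b V P) :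
    IsSelfSimilarEulerSolution (-a) (-b) (fun y s => -V y (-s)) (fun y s => P y (-s)) where
  differentiable_pressure s := h.differentiable_pressure (-s)
  momentum y s := by
    have h1 := spaceDeriv_reverse V (y, s)
    simp only [spaceDeriv] at h1
    have h2 : deriv (fun s => -V y (-s)) s = deriv (V y) (-s) := by
      rw [deriv.fun_neg, deriv_comp_neg, neg_neg]
    rw [h1, h2, ← h.momentum y (-s)]
    simp
  incompressible y s := by
    have h1 := spaceDeriv_reverse V (y, s)
    simp only [spaceDeriv] at h1
    have := h.incompressible y (-s)
    simp only [divergence, partialComp, h1, neg_apply, PiLp.neg_apply, Finset.sum_neg_distrib] at this ⊢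
    rw [this, neg_zero]

theorem norm_vorticity_le (V : E3 → ℝ → E3) (p : E3 × ℝ) :
    ‖vorticity V p‖ ≤ 6 * ‖spaceDeriv V p‖ := by
  have hcomp : ∀ (x : E3) (i : Fin 3), |x i| ≤ ‖x‖ := fun x i => by
    simpa using PiLp.norm_apply_le x i
  have hp : ∀ i j, |spaceDeriv V p (e3 j) i| ≤ ‖spaceDeriv V p‖ := fun i j => by
    refine (hcomp _ _).trans ?_
    simpa using (spaceDeriv V p).le_opNorm (e3 j)
  have hi : ∀ i, |vorticity V p i| ≤ 2 * ‖spaceDeriv V p‖ := fun i => by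
    rw [vorticity, curl_apply]
    refine (abs_sub _ _).trans ?_
    have h1 := hp (i + 2) (i + 1)
    have h2 := hp (i + 1) (i + 2)
    simp only [spaceDeriv] at h1 h2
    simp only [partialComp, spaceDeriv]
    linarith
  rw [sum_smul_e3 (vorticity V p)]
  refine (norm_add₃_le).trans ?_
  have h0 := hi 0
  have h1 := hi 1
  have h2 := hi 2
  simp only [norm_smul, PiLp.norm_single, norm_one, mul_one, Real.norm_eq_abs]
  linarith

theorem eq_zero_of_localExtr_of_spaceDeriv_isLittleO (hS : 0 < S) (hv : ContDiff ℝ 1 (uncurry V))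
    (hw : ContDiff ℝ 1 (vorticity V)) (hsol : IsSelfSimilarEulerSolution a b V P)
    (hper : ∀ y, Function.Periodic (V y) S) (hb : b ≠ 0) {c : ℝ}
    (hextr : ∀ s ∈ Ioo c (c + S), ∀ i : Fin 3, IsLocalExtr (fun y => V y s i) 0)
    (hzero : ∀ s ∈ Ioo c (c + S), V 0 s = 0) {m : ℕ} (hm : 0 < b * (m * b + (a + b))) {s₁ : ℝ}
    (h₁ : (fun y => spaceDeriv V (y, s₁)) =o[𝓝 0] fun y => ‖y‖ ^ m)
    (y : E3) (s : ℝ) : V y s = 0 := by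
  have hω : ∀ {W : E3 → ℝ → E3} {s₁ : ℝ}
      (_ : (fun y => spaceDeriv W (y, s₁)) =o[𝓝 0] fun y => ‖y‖ ^ m),
      ∀ η > 0, ∃ ρ > 0, ∀ y, ‖y‖ ≤ ρ → ‖vorticity W (y, s₁)‖ ≤ η * ‖y‖ ^ m := by
    intro W s₁ h η hη
    obtain ⟨ρ, hρ, hball⟩ := Metric.eventually_nhds_iff.1
      (isLittleO_iff.1 h (show 0 < η / 6 by positivity))
    refine ⟨ρ / 2, by positivity, fun y hy => (norm_vorticity_le W _).trans ?_⟩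
    have := hball (show dist y 0 < ρ by rw [dist_zero_right]; linarith)
    rw [norm_pow, norm_norm] at this
    linarith
  rcases lt_or_gt_of_ne hb with hb | hb
  -- Time reversal sends `(c, c + S)` to `(-(c + S), -c)`, which is why the interval has a free left
  -- endpoint.
  · have key := eq_zero_of_localExtr_of_vorticity_isLittleO (a := -a) (b := -b) (S := S) (m := m)
      (V := fun y s => -V y (-s)) (c := -(c + S)) (s₁ := -s₁) hS ?_ ?_ hsol.reverse ?_ (by linarith)
      ?_ ?_ ?_ (hω ?_) y (-s)
    · simpa using key
    · exact (hv.comp (contDiff_fst.prodMk contDiff_snd.neg)).neg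
    · rw [funext (vorticity_reverse V)]
      exact (hw.comp (contDiff_fst.prodMk contDiff_snd.neg)).neg
    · intro y s
      simp only
      rw [neg_add, ← sub_eq_add_neg, (hper y).sub_eq]
    · intro s hs i
      have := hextr (-s) ⟨by linarith [hs.2], by linarith [hs.1]⟩ i
      exact this.neg
    · intro s hs
      simp only [hzero (-s) ⟨by linarith [hs.2], by linarith [hs.1]⟩, neg_zero]
    · nlinarith [neg_of_mul_pos_right hm hb.le]
    · simp only [spaceDeriv_reverse, neg_neg]
      exact h₁.neg_left
  · exact eq_zero_of_localExtr_of_vorticity_isLittleO hS hv hw hsol hper hb hextr hzero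
      ((pos_iff_pos_of_mul_pos hm).1 hb) (hω h₁) y s

end Final

theorem theorem1p2
    (a b δ S₀ : ℝ) (hb : b ≠ 0) (hδ₀ : 0 < δ) (hδ₁ : δ < 1) (hS₀ : 0 < S₀)
    (V : E3 → ℝ → E3) (P : E3 → ℝ → ℝ)
    (hV : IsC1TimeHolderSpace 1 δ Set.univ Set.univ V)
    (hcurl : ContDiff ℝ 1 (fun p : E3 × ℝ => curl (fun y => V y p.2) p.1))
    (hsol : IsSelfSimilarEulerSolution a b V P)
    (hper : ∀ y, Function.Periodic (V y) S₀)
    (hextr : ∀ s ∈ Set.Ioo 0 S₀, ∀ i : Fin 3, IsLocalExtr (fun y => V y s i) 0)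
    (hcase₁ : (0 < a + b ∧ 0 < b) ∨ (a + b < 0 ∧ b < 0) →
      ∀ s ∈ Set.Ioo 0 S₀, V 0 s = 0)
    (hcase₂ : (a + b ≤ 0 ∧ 0 < b) ∨ (0 ≤ a + b ∧ b < 0) →
      ∃ ρ : ℝ, 0 < ρ ∧ ∃ β : ℝ, |a + b| / |b| + 2 < β ∧
        IsC1TimeHolderSpace ⌊β⌋₊ (β - ⌊β⌋₊) (Metric.ball 0 ρ) (Set.Ioo 0 S₀) V ∧
        ∀ k ≤ ⌊β⌋₊, ∀ s ∈ Set.Ioo 0 S₀, iteratedFDeriv ℝ k (fun y => V y s) 0 = 0) :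
    ∀ y s, V y s = 0 := by
  have hv := hV.contDiff_uncurry
  have hs₁ : S₀ / 2 ∈ Ioo 0 S₀ := ⟨by linarith, by linarith⟩
  suffices h : (∀ s ∈ Ioo 0 S₀, V 0 s = 0) ∧ ∃ m : ℕ, 0 < b * (m * b + (a + b)) ∧
      (fun y => spaceDeriv V (y, S₀ / 2)) =o[𝓝 0] fun y => ‖y‖ ^ m by
    obtain ⟨hzero, m, hm, ho⟩ := h
    exact eq_zero_of_localExtr_of_spaceDeriv_isLittleO (c := 0) hS₀ hv hcurl hsol hper hb
      (by simpa using hextr) (by simpa using hzero) hm ho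
  -- When `b` and `a + b` have the same sign, `m = 0` suffices and `DV(0) = 0` is enough; otherwise
  -- the higher order vanishing is needed.
  by_cases hcase : 0 < b * (a + b)
  · refine ⟨hcase₁ ?_, 0, by simpa using hcase, ?_⟩
    · rcases pos_and_pos_or_neg_and_neg_of_mul_pos hcase with h | h
      · exact Or.inl h.symm
      · exact Or.inr h.symm
    · have hD0 : spaceDeriv V (0, S₀ / 2) = 0 := by
        ext v i
        have h2 := fderiv_comp_apply ((contDiff_slice hv (S₀ / 2)).differentiable (by simp) 0) i v
        rw [(hextr _ hs₁ i).fderiv_eq_zero] at h2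
        simpa [spaceDeriv] using h2.symm
      simp only [pow_zero]
      rw [isLittleO_one_iff, ← hD0]
      exact ((continuous_spaceDeriv hv).comp
        (by fun_prop : Continuous fun y : E3 => (y, S₀ / 2))).tendsto 0
  · obtain ⟨ρ, hρ, β, hβ, hreg, hvan⟩ := hcase₂ (by
      rcases lt_or_gt_of_ne hb with h | h
      · right; exact ⟨by by_contra! hlt; exact hcase (mul_pos_of_neg_of_neg h hlt), h⟩
      · left; exact ⟨by by_contra! hlt; exact hcase (mul_pos h hlt), h⟩)
    have hbpos : 0 < |b| := abs_pos.2 hb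
    have hq : 0 ≤ |a + b| / |b| := by positivity
    have hβ2 : 2 ≤ ⌊β⌋₊ := Nat.le_floor (by push_cast; linarith)
    -- One order is lost in passing from `V` to `DV`, and less than one in the integer part; the `+
    -- 2` in the bound on `β` therefore leaves `m > |a + b| / |b|`.
    obtain ⟨m, hm⟩ : ∃ m, ⌊β⌋₊ = m + 1 := ⟨⌊β⌋₊ - 1, by omega⟩
    have hmβ : |a + b| / |b| < m := by
      have h1 := Nat.lt_floor_add_one β
      rw [hm] at h1
      push_cast at h1
      linarith
    rw [hm] at hvan hreg
    refine ⟨fun s hs => ?_, m, ?_, ?_⟩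
    · have := hvan 0 (by omega) s hs
      rwa [← norm_eq_zero, norm_iteratedFDeriv_zero, norm_eq_zero] at this
    · rw [div_lt_iff₀ hbpos] at hmβ
      have h1 := neg_abs_le (b * (a + b))
      rw [abs_mul] at h1
      nlinarith [sq_abs b]
    · have hC : ContDiffAt ℝ (m + 1 : ℕ) (fun y => V y (S₀ / 2)) 0 :=
        (hreg.contDiffOn_space _ hs₁).contDiffAt (Metric.ball_mem_nhds _ hρ)
      have hC' : ContDiffAt ℝ m (fderiv ℝ fun y => V y (S₀ / 2)) 0 :=
        hC.fderiv_right (by norm_cast)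
      have ho := isLittleO_pow_of_iteratedFDeriv_eq_zero m hC' fun k hk => by
        rw [← norm_eq_zero, norm_iteratedFDeriv_fderiv, hvan (k + 1) (by omega) _ hs₁, norm_zero]
      exact ho
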